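/- **Setting.** Let $p\in\mathbb N$, $\Theta\subset\mathbb R^p$, let $U$ be a random element with distribution $Q$ and $\ell(\theta;u)$ a real loss function with $g(\theta)=E[\ell(\theta;U)]$. For every $n$ let $\mathbf U_n=(U_1,\dots,U_n)$ be i.i.d. with distribution $Q$ (on a probability space that may depend on $n$), and put $\mathcal L^n(\theta;\mathbf U_n)=\frac1n\sum_{i=1}^n\ell(\theta;U_i)$. $\nabla$ and $H$ denote the gradient and the Hessian matrix with respect to $\theta$. Fix $T>0$ and $x_0\in\mathbb R^p$, and give $C([0,T])$, the space of continuous functions on $[0,T]$, the uniform metric. Consider one of the two cases: * (plain) $X$ solves $\dot X+\nabla g(X)=0$, $X(0)=x_0$, and $X^n$ solves $\dot X^n+\nabla\mathcal L^n(X^n;\mathbf U_n)=0$, $X^n(0)=x_0^n$; * (accelerated) $X$ and $X^n$ are continuously differentiable on $[0,T]$ and solve on $(0,T]$ $\ddot X+\frac3t\dot X+\nabla g(X)=0$, $X(0)=x_0$, $\dot X(0)=0$, and $\ddot X^n+\frac3t\dot X^n+\nabla\mathcal L^n(X^n;\mathbf U_n)=0$, $X^n(0)=x_0^n$, $\dot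 X^n(0)=0$. Here $X$ is deterministic, while $x^n_0$ and $X^n$ are random; $X^n$ is a random element of $C([0,T])$, defined on the probability space of $\mathbf U_n$, which almost surely takes values in $\Theta$ and solves its equation on $[0,T]$. **Assumptions.** * A0. $\sqrt n\,(x^n_0-x_0)\to0$ in probability. * A1. For every $u$, $\ell(\cdot;u)$ is twice continuously differentiable near every point of $\Theta$, and $\|\nabla\ell(\theta;u)-\nabla\ell(\vartheta;u)\|\le h_1(u)\|\theta-\vartheta\|$ for all $\theta,\vartheta\in\Theta$, where $h_1(U)$ and, for some $\theta_0\in\Theta$, $\nabla\ell(\theta_0;U)$ have finite fourth moments. * A2. On $\Theta$: $E[\ell(\theta;U)]=g(\theta)$, $E[\nabla\ell(\theta;U)]=\nabla g(\theta)$, $E[H\ell(\theta;U)]=Hg(\theta)$ (the expectations exist); $g$ is twice continuously differentiable near every point of $\Theta$ and strongly convex on $\Theta$ (so $\Theta$ is convex), and $\nabla g$ is Lipschitz on $\Theta$. * A3. The entries of $\varsigma(\theta,\vartheta)=\big(\mathrm{Cov}[\partial_i\ell(\theta;U),\partial_j\ell(\vartheta;U)]\big)_{1\le i,j\le p}$ are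 continuously differentiable and Lipschitz on $\Theta\times\Theta$, and $\varsigma(\theta,\theta)$ is positive definite for $\theta\in\Theta$. Let $\sigma(\theta)$ be the positive definite square root of $\varsigma(\theta,\theta)$. * A4. $\Theta_X\subset\Theta$ is bounded and its interior contains $X(t)$ for all $t\in[0,T]$. $\mathbf Z=(\mathbf Z(\theta))_{\theta\in\Theta_X}$ is an $\mathbb R^p$-valued Gaussian process with mean zero and auto-covariance $\varsigma(\theta,\vartheta)$, and $\sqrt n\,[\nabla\mathcal L^n(\theta;\mathbf U_n)-\nabla g(\theta)]$ converges weakly to $\mathbf Z(\theta)$ uniformly over $\theta\in\Theta_X$, that is, as random elements of the space of bounded continuous functions on $\Theta_X$ with the uniform metric (in particular $\mathbf Z$ has almost surely bounded continuous paths on $\Theta_X$). **Theorem 3.1.** Under A0–A4, in each of the two cases, $V^n=\sqrt n\,(X^n-X)$ converges weakly in $C([0,T])$, as $n\to\infty$, to a random element $V$ of $C([0,T])$, defined on the probability space of $\mathbf Z$, that is almost surely the unique solution on $[0,T]$ of $$\dot V(t)+Hg(X(t))\,V(t)+\mathbf Z(X(t))=0,\qquad V(0)=0,$$ in the plain case,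 and of $$\ddot V(t)+\frac3t\,\dot V(t)+Hg(X(t))\,V(t)+\mathbf Z(X(t))=0,\qquad V(0)=\dot V(0)=0,$$ in the accelerated case. If in particular $\mathbf Z(\theta)=\sigma(\theta)\mathbf Z_0$ almost surely for each $\theta\in\Theta_X$, with a random vector $\mathbf Z_0\sim N_p(0,\mathbf I_p)$, then almost surely $V(t)=\Pi(t)\mathbf Z_0$ for all $t\in[0,T]$, where the deterministic $p\times p$ matrix function $\Pi$ is the unique solution on $[0,T]$ of $$\dot\Pi(t)+Hg(X(t))\,\Pi(t)+\sigma(X(t))=0,\qquad \Pi(0)=0,$$ in the plain case, and of $$\ddot\Pi(t)+\frac3t\,\dot\Pi(t)+Hg(X(t))\,\Pi(t)+\sigma(X(t))=0,\qquad \Pi(0)=\dot\Pi(0)=0,$$ in the accelerated case. (Second-order equations hold on $(0,T]$ for functions that are continuously differentiable on $[0,T]$.) -/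

import Mathlib

open MeasureTheory ProbabilityTheory Filter Set
open scoped Topology Gradient BoundedContinuousFunction NNReal Matrix MatrixOrder
open scoped Matrix.Norms.L2Operator

noncomputable section

/-- The Euclidean space `ℝᵖ`. -/
abbrev Euc (p : ℕ) : Type := EuclideanSpace ℝ (Fin p)

/-- The space `C([0,T]; F)`; for normed `F` its Mathlib norm is the uniform norm. -/
abbrev PathSpace (T : ℝ) (F : Type*) [TopologicalSpace F] : Type _ := C(Icc (0 : ℝ) T, F)

/-- The Borel σ-algebra of the space of continuous functions with the uniform metric. -/
instance continuousMapBorel {K F : Type*} [TopologicalSpace K] [TopologicalSpace F] :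
    MeasurableSpace C(K, F) := borel _

instance continuousMapBorelSpace {K F : Type*} [TopologicalSpace K] [TopologicalSpace F] :
    BorelSpace C(K, F) := ⟨rfl⟩

/-- The Borel σ-algebra of the space of bounded continuous functions with the uniform metric. -/
instance boundedContinuousBorel {S F : Type*} [TopologicalSpace S] [PseudoMetricSpace F] :
    MeasurableSpace (S →ᵇ F) := borel _

instance boundedContinuousBorelSpace {S F : Type*} [TopologicalSpace S] [PseudoMetricSpace F] :
    BorelSpace (S →ᵇ F) := ⟨rfl⟩

/-- The Hessian matrix `(∂ⱼ ∂ᵢ f (θ))ᵢⱼ`. -/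
def hessianMatrix {p : ℕ} (f : Euc p → ℝ) (θ : Euc p) : Matrix (Fin p) (Fin p) ℝ :=
  Matrix.of fun i j => (fderiv ℝ (∇ f) θ (EuclideanSpace.single j 1)) i

/-- The empirical objective `𝓛ⁿ(θ; u₁, …, uₙ) = n⁻¹ ∑ᵢ ℓ(θ; uᵢ)`. -/
def empiricalLoss {p : ℕ} {𝒰 : Type*} (ℓ : Euc p → 𝒰 → ℝ) {n : ℕ} (u : Fin n → 𝒰)
    (θ : Euc p) : ℝ :=
  (n : ℝ)⁻¹ * ∑ i, ℓ θ (u i)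

/-- The centered and scaled empirical gradient `√n (∇𝓛ⁿ(θ; u₁, …, uₙ) - ∇g(θ))`. -/
def centeredGradient {p : ℕ} {𝒰 : Type*} (ℓ : Euc p → 𝒰 → ℝ) (g : Euc p → ℝ) {n : ℕ}
    (u : Fin n → 𝒰) (θ : Euc p) : Euc p :=
  Real.sqrt n • (∇ (empiricalLoss ℓ u) θ - ∇ g θ)

/-- The cross covariance matrix `ς(θ, ϑ)` of `∇ℓ(θ; U)` and `∇ℓ(ϑ; U)`, where `U ∼ Q`. -/
def crossCov {p : ℕ} {𝒰 : Type*} [MeasurableSpace 𝒰] (ℓ : Euc p → 𝒰 → ℝ) (Q : Measure 𝒰)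
    (θ ϑ : Euc p) : Matrix (Fin p) (Fin p) ℝ :=
  Matrix.of fun i j =>
    covariance (fun u => (∇ (fun η => ℓ η u) θ) i) (fun u => (∇ (fun η => ℓ η u) ϑ) j) Q

/-- `σ(θ)`, the positive square root of `σ²(θ) = Var[∇ℓ(θ; U)] = ς(θ, θ)`. -/
def sigmaMatrix {p : ℕ} {𝒰 : Type*} [MeasurableSpace 𝒰] (ℓ : Euc p → 𝒰 → ℝ) (Q : Measure 𝒰)
    (θ : Euc p) : Matrix (Fin p) (Fin p) ℝ :=
  CFC.sqrt (crossCov ℓ Q θ θ)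

/-- For every `n`, the variables `U n 0, …, U n (n-1)` are i.i.d. with law `Q`; the probability
space may change with `n`. -/
def IsIIDSample {𝒰 : Type*} [MeasurableSpace 𝒰] (Q : Measure 𝒰) {Ω : ℕ → Type*}
    [∀ n, MeasurableSpace (Ω n)] (P : ∀ n, Measure (Ω n)) (U : ∀ n, Fin n → Ω n → 𝒰) : Prop :=
  ∀ n, iIndepFun (U n) (P n) ∧ ∀ i, HasLaw (U n i) Q (P n)

/-- `ξ n = o_P(n^{-1/2})`. -/
def IsLittleOPRootN {p : ℕ} {Ω : ℕ → Type*} [∀ n, MeasurableSpace (Ω n)]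
    (P : ∀ n, Measure (Ω n)) (ξ : ∀ n, Ω n → Euc p) : Prop :=
  ∀ ε : ℝ, 0 < ε →
    Tendsto (fun n : ℕ => P n {ω | ε ≤ Real.sqrt n * ‖ξ n ω‖}) atTop (𝓝 0)

/-- Smoothness of the loss, with a random Lipschitz constant for its gradient. -/
structure LossRegularity {p : ℕ} {𝒰 : Type*} [MeasurableSpace 𝒰] (Q : Measure 𝒰)
    (Θ : Set (Euc p)) (ℓ : Euc p → 𝒰 → ℝ) : Prop where
  contDiff : ∀ u, ∀ θ ∈ Θ, ContDiffAt ℝ 2 (fun η => ℓ η u) θ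
  lipschitz : ∃ h₁ : 𝒰 → ℝ, MemLp h₁ 4 Q ∧ ∀ u, ∀ θ ∈ Θ, ∀ ϑ ∈ Θ,
    ‖∇ (fun η => ℓ η u) θ - ∇ (fun η => ℓ η u) ϑ‖ ≤ h₁ u * ‖θ - ϑ‖
  moment : ∃ θ₀ ∈ Θ, MemLp (fun u => ∇ (fun η => ℓ η u) θ₀) 4 Q

/-- `g(θ) = E ℓ(θ; U)`, differentiation and expectation commute, and `g` is `C²`, strongly convex
and has a Lipschitz gradient on `Θ`. -/
structure PopulationRegularity {p : ℕ} {𝒰 : Type*} [MeasurableSpace 𝒰] (Q : Measure 𝒰)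
    (Θ : Set (Euc p)) (ℓ : Euc p → 𝒰 → ℝ) (g : Euc p → ℝ) : Prop where
  expect_loss : ∀ θ ∈ Θ, Integrable (ℓ θ) Q ∧ ∫ u, ℓ θ u ∂Q = g θ
  expect_grad : ∀ θ ∈ Θ, Integrable (fun u => ∇ (fun η => ℓ η u) θ) Q ∧
    ∫ u, ∇ (fun η => ℓ η u) θ ∂Q = ∇ g θ
  expect_hessian : ∀ θ ∈ Θ, ∀ i j,
    Integrable (fun u => hessianMatrix (fun η => ℓ η u) θ i j) Q ∧
      ∫ u, hessianMatrix (fun η => ℓ η u) θ i j ∂Q = hessianMatrix g θ i j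
  contDiff : ∀ θ ∈ Θ, ContDiffAt ℝ 2 g θ
  strongConvex : ∃ μ : ℝ, 0 < μ ∧ StrongConvexOn Θ μ g
  lipschitz : ∃ L : ℝ≥0, 0 < L ∧ LipschitzOnWith L (∇ g) Θ

/-- Regularity of the cross covariance and positive definiteness of `σ²(θ) = ς(θ, θ)`. -/
structure CovarianceRegularity {p : ℕ} {𝒰 : Type*} [MeasurableSpace 𝒰] (Q : Measure 𝒰)
    (Θ : Set (Euc p)) (ℓ : Euc p → 𝒰 → ℝ) : Prop where
  contDiff : ∀ i j, ContDiffOn ℝ 1 (fun z : Euc p × Euc p => crossCov ℓ Q z.1 z.2 i j) (Θ ×ˢ Θ)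
  lipschitz : ∃ L : ℝ≥0, 0 < L ∧ ∀ i j,
    LipschitzOnWith L (fun z : Euc p × Euc p => crossCov ℓ Q z.1 z.2 i j) (Θ ×ˢ Θ)
  posDef : ∀ θ ∈ Θ, (crossCov ℓ Q θ θ).PosDef

/-- Weak convergence, uniformly over `S`, of processes `R n` indexed by `S` to a process `Z`:
up to null sets their sample paths on `S` are bounded and continuous, and as random elements of
the space of bounded continuous functions on `S` with the uniform metric they converge in
distribution. -/
def WeaklyConvergesOn {p : ℕ} (S : Set (Euc p)) {Ω : ℕ → Type*} [∀ n, MeasurableSpace (Ω n)]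
    (P : ∀ n, Measure (Ω n)) [∀ n, IsProbabilityMeasure (P n)]
    {Ω' : Type*} [MeasurableSpace Ω'] (P' : Measure Ω') [IsProbabilityMeasure P']
    (R : ∀ n, Euc p → Ω n → Euc p) (Z : Euc p → Ω' → Euc p) : Prop :=
  ∃ (R' : ∀ n, Ω n → (S →ᵇ Euc p)) (Z' : Ω' → (S →ᵇ Euc p)),
    (∀ n, ∀ᵐ ω ∂(P n), ∀ θ : S, R' n ω θ = R n θ ω) ∧
    (∀ᵐ ω ∂P', ∀ θ : S, Z' ω θ = Z θ ω) ∧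
    TendstoInDistribution R' atTop Z' P P'

/-- On `Θ_X`, `Z` is a centered Gaussian process with auto-covariance `ς`, and it is the weak
limit, uniformly over `Θ_X`, of the centered and scaled empirical gradients. -/
structure GradientCLT {p : ℕ} {𝒰 : Type*} [MeasurableSpace 𝒰] (Q : Measure 𝒰)
    (ΘX : Set (Euc p)) (ℓ : Euc p → 𝒰 → ℝ) (g : Euc p → ℝ)
    {Ω : ℕ → Type*} [∀ n, MeasurableSpace (Ω n)]
    (P : ∀ n, Measure (Ω n)) [∀ n, IsProbabilityMeasure (P n)] (U : ∀ n, Fin n → Ω n → 𝒰)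
    {Ω' : Type*} [MeasurableSpace Ω'] (P' : Measure Ω') [IsProbabilityMeasure P']
    (Z : Euc p → Ω' → Euc p) : Prop where
  gaussian : IsGaussianProcess (fun θ : ΘX => Z θ) P'
  mean_zero : ∀ θ ∈ ΘX, ∫ ω, Z θ ω ∂P' = 0
  auto_cov : ∀ θ ∈ ΘX, ∀ ϑ ∈ ΘX, ∀ i j,
    covariance (fun ω => Z θ ω i) (fun ω => Z ϑ ω j) P' = crossCov ℓ Q θ ϑ i j
  weak_limit : WeaklyConvergesOn ΘX P P'
    (fun n θ ω => centeredGradient ℓ g (fun i => U n i ω) θ) Z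

/-- `x ∈ C([0,T]; F)` solves `ẋ(t) + b(t, x(t)) = 0` on `[0,T]` with `x(0) = x₀`
(one-sided derivatives at the end points). -/
def SolvesFirstOrder {F : Type*} [NormedAddCommGroup F] [NormedSpace ℝ F] {T : ℝ} (hT : 0 ≤ T)
    (b : Icc (0 : ℝ) T → F → F) (x₀ : F) (x : PathSpace T F) : Prop :=
  x ⟨0, left_mem_Icc.mpr hT⟩ = x₀ ∧
  ∀ t : Icc (0 : ℝ) T, HasDerivWithinAt (IccExtend hT x) (-(b t (x t))) (Icc 0 T) t

/-- `x ∈ C([0,T]; F)` is continuously differentiable on `[0,T]`, solves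
`ẍ(t) + (3/t) ẋ(t) + b(t, x(t)) = 0` on `(0,T]`, and `x(0) = x₀`, `ẋ(0) = 0`. -/
def SolvesNesterov {F : Type*} [NormedAddCommGroup F] [NormedSpace ℝ F] {T : ℝ} (hT : 0 ≤ T)
    (b : Icc (0 : ℝ) T → F → F) (x₀ : F) (x : PathSpace T F) : Prop :=
  ∃ x' : PathSpace T F,
    x ⟨0, left_mem_Icc.mpr hT⟩ = x₀ ∧ x' ⟨0, left_mem_Icc.mpr hT⟩ = 0 ∧
    (∀ t : Icc (0 : ℝ) T, HasDerivWithinAt (IccExtend hT x) (x' t) (Icc 0 T) t) ∧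
    ∀ t : Icc (0 : ℝ) T, 0 < (t : ℝ) →
      HasDerivWithinAt (IccExtend hT x') (-((3 / (t : ℝ)) • x' t + b t (x t))) (Icc 0 T) t

/-- The two cases: plain gradient descent and (Nesterov) accelerated gradient descent. -/
inductive Scheme
  | plain
  | accelerated

/-- The initial value problem attached to the case at hand. -/
def Scheme.Solves {F : Type*} [NormedAddCommGroup F] [NormedSpace ℝ F] (s : Scheme) {T : ℝ}
    (hT : 0 ≤ T) (b : Icc (0 : ℝ) T → F → F) (x₀ : F) (x : PathSpace T F) : Prop :=
  match s with
  | .plain => SolvesFirstOrder hT b x₀ x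
  | .accelerated => SolvesNesterov hT b x₀ x

end

/-! ### Linear solution operators of the two initial value problems -/

section SolutionOperators

variable {F : Type*} [NormedAddCommGroup F] {T : ℝ}

/-! Both problems are Volterra equations `x = x₀ + S f`, with `f` the vector field along `x`. In the
plain case `S f = -∫ f`. In the accelerated case the equation reads `(t³ẋ)' = -t³f`, so the velocity
is `-t⁻³ ∫₀ᵗ r³ f`, and a second integration gives `S f`. Either way `‖S f(t)‖ ≤ max 1 T * ∫₀ᵗ ‖f‖`
(`Scheme.norm_forcingMap_apply_le`), so the singular coefficient `3/t` causes no trouble and the two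
cases share all later arguments.

For a linear field `A x + f`, the iterates of `S A` decay factorially, so `1 - S A` is invertible
and the solution is `Φ f` with `Φ` a bounded linear map (`Scheme.exists_linear_solution`). The limit
is `V = Φ(Z ∘ X)`.

Let `Rₙ = √n(∇𝓛ⁿ - ∇g)`. The forcing of `Vⁿ` is `√n(∇𝓛ⁿ(Xⁿ) - ∇g(X))`, that is `Rₙ(X) + Hg(X)Vⁿ`
plus an increment of `Rₙ` between `X` and `Xⁿ` and a Taylor remainder of `∇g`. Grönwall's
inequality, with the empirical Lipschitz constant, bounds `Vⁿ` in probability. Hence `Xⁿ` stays in a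
thin tube around `X`, where both errors are small (`Scheme.norm_smul_sub_sub_le`). So `Vⁿ - Φ(Rₙ ∘
X) → 0` in probability, and continuous mapping with Slutsky's theorem concludes. If `Z = σ Z₀`,
applying the matrix solution to `Z₀` solves the same linear equation, and uniqueness identifies it
with `V`. -/

theorem PathSpace.continuous_extend (hT : 0 ≤ T) (f : PathSpace T F) :
    Continuous (IccExtend hT f) :=
  f.continuous.Icc_extend'

theorem PathSpace.extend_apply (hT : 0 ≤ T) (f : PathSpace T F) (t : Icc (0 : ℝ) T) :
    IccExtend hT f t = f t :=
  IccExtend_val hT f t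

theorem integral_norm_extend_mono (hT : 0 ≤ T) (f : PathSpace T F) {r t : ℝ} (hr : 0 ≤ r)
    (hrt : r ≤ t) :
    ∫ u in (0 : ℝ)..r, ‖IccExtend hT f u‖ ≤ ∫ u in (0 : ℝ)..t, ‖IccExtend hT f u‖ :=
  intervalIntegral.integral_mono_interval le_rfl hr hrt
    (Eventually.of_forall fun _ => norm_nonneg _)
    ((f.continuous_extend hT).norm.intervalIntegrable _ _)

variable [NormedSpace ℝ F]

/-- Derivatives within `[0,T]` of an extended path only depend on its values on `[0,T]`. -/
theorem PathSpace.hasDerivWithinAt_extend (hT : 0 ≤ T) {f : PathSpace T F} {φ : ℝ → F} {φ' : F}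
    {t : Icc (0 : ℝ) T} (h : HasDerivWithinAt φ φ' (Icc 0 T) t) (hf : ∀ r, f r = φ r) :
    HasDerivWithinAt (IccExtend hT f) φ' (Icc 0 T) t := by
  refine h.congr (fun r hr => ?_) ?_
  · rw [IccExtend_of_mem hT f hr, hf]
  · rw [PathSpace.extend_apply, hf]

/-- `t ↦ ∫₀ᵗ f` as a linear map on paths. -/
noncomputable def pathPrimitive (hT : 0 ≤ T) : PathSpace T F →ₗ[ℝ] PathSpace T F where
  toFun f :=
    { toFun := fun t => ∫ r in (0 : ℝ)..t, IccExtend hT f r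
      continuous_toFun := (intervalIntegral.continuous_primitive
        (fun a b => (f.continuous_extend hT).intervalIntegrable a b) 0).comp
          continuous_subtype_val }
  map_add' f h := by
    ext t
    have : IccExtend hT (f + h) = fun r => IccExtend hT f r + IccExtend hT h r := rfl
    simp only [ContinuousMap.coe_mk, ContinuousMap.add_apply, this]
    exact intervalIntegral.integral_add ((f.continuous_extend hT).intervalIntegrable _ _)
      ((h.continuous_extend hT).intervalIntegrable _ _)
  map_smul' c f := by
    ext t
    have : IccExtend hT (c • f) = fun r => c • IccExtend hT f r := rfl
    simp only [ContinuousMap.coe_mk, ContinuousMap.smul_apply, this, RingHom.id_apply]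
    exact intervalIntegral.integral_smul _ _

theorem pathPrimitive_apply (hT : 0 ≤ T) (f : PathSpace T F) (t : Icc (0 : ℝ) T) :
    pathPrimitive hT f t = ∫ r in (0 : ℝ)..t, IccExtend hT f r := rfl

theorem norm_pathPrimitive_le (hT : 0 ≤ T) (f : PathSpace T F) (t : Icc (0 : ℝ) T) :
    ‖pathPrimitive hT f t‖ ≤ ∫ r in (0 : ℝ)..t, ‖IccExtend hT f r‖ :=
  intervalIntegral.norm_integral_le_integral_norm t.2.1

theorem hasDerivWithinAt_pathPrimitive [CompleteSpace F] (hT : 0 ≤ T) (f : PathSpace T F)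
    (t : Icc (0 : ℝ) T) :
    HasDerivWithinAt (IccExtend hT (pathPrimitive hT f)) (f t) (Icc 0 T) t := by
  have h := ((f.continuous_extend hT).integral_hasStrictDerivAt 0 t).hasDerivAt.hasDerivWithinAt
    (s := Icc 0 T)
  rw [PathSpace.extend_apply] at h
  exact PathSpace.hasDerivWithinAt_extend hT h fun r => rfl

theorem continuous_cube_smul_extend (hT : 0 ≤ T) (f : PathSpace T F) :
    Continuous fun r : ℝ => r ^ 3 • IccExtend hT f r :=
  (continuous_id.pow 3).smul (f.continuous_extend hT)

/-- The weight `r³/t³` is at most `1` on `[0,t]`; at `t = 0` the left side vanishes. The bound tames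
the singularity and also yields continuity of the mean at `0`. -/
theorem norm_dampedMean_le (hT : 0 ≤ T) (f : PathSpace T F) {t : ℝ} (ht : 0 ≤ t) :
    ‖(t ^ 3)⁻¹ • ∫ r in (0 : ℝ)..t, r ^ 3 • IccExtend hT f r‖ ≤
      ∫ r in (0 : ℝ)..t, ‖IccExtend hT f r‖ := by
  have hint : 0 ≤ ∫ r in (0 : ℝ)..t, ‖IccExtend hT f r‖ :=
    intervalIntegral.integral_nonneg ht fun _ _ => norm_nonneg _
  have h : ‖∫ r in (0 : ℝ)..t, r ^ 3 • IccExtend hT f r‖ ≤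
      t ^ 3 * ∫ r in (0 : ℝ)..t, ‖IccExtend hT f r‖ := by
    rw [← intervalIntegral.integral_const_mul]
    refine (intervalIntegral.norm_integral_le_integral_norm ht).trans
      (intervalIntegral.integral_mono_on ht
        ((continuous_cube_smul_extend hT f).norm.intervalIntegrable _ _)
        ((continuous_const.mul (f.continuous_extend hT).norm).intervalIntegrable _ _) ?_)
    intro r hr
    rw [norm_smul, Real.norm_of_nonneg (pow_nonneg hr.1 3)]
    gcongr
    exacts [hr.1, hr.2]
  rw [norm_smul, Real.norm_of_nonneg (by positivity)]
  rcases ht.eq_or_lt with rfl | ht'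
  · simp
  · rw [inv_mul_le_iff₀ (by positivity)]
    exact h

/-- `t ↦ t⁻³ ∫₀ᵗ r³ f(r) dr`, with value `0` at `t = 0`, as a linear map on paths. -/
noncomputable def dampedMean (hT : 0 ≤ T) : PathSpace T F →ₗ[ℝ] PathSpace T F where
  toFun f :=
    { toFun := fun t => ((t : ℝ) ^ 3)⁻¹ • ∫ r in (0 : ℝ)..t, r ^ 3 • IccExtend hT f r
      continuous_toFun := by
        have hprim : Continuous fun t : Icc (0 : ℝ) T =>
            ∫ r in (0 : ℝ)..t, r ^ 3 • IccExtend hT f r :=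
          (intervalIntegral.continuous_primitive (fun a b =>
            (continuous_cube_smul_extend hT f).intervalIntegrable a b) 0).comp
              continuous_subtype_val
        have hnorm : Continuous fun t : Icc (0 : ℝ) T =>
            ∫ r in (0 : ℝ)..t, ‖IccExtend hT f r‖ :=
          (intervalIntegral.continuous_primitive (fun a b =>
            (f.continuous_extend hT).norm.intervalIntegrable a b) 0).comp
              continuous_subtype_val
        rw [continuous_iff_continuousAt]
        intro t
        -- At time `0` the formula gives `0` because `0⁻¹ = 0`, and the norm bound squeezes nearby
        -- values to `0`.
        rcases t.2.1.eq_or_lt with h0 | hpos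
        · have hlim : Tendsto (fun t : Icc (0 : ℝ) T =>
              ∫ r in (0 : ℝ)..t, ‖IccExtend hT f r‖) (𝓝 t) (𝓝 0) := by
            have := hnorm.tendsto t
            rwa [← h0, intervalIntegral.integral_same] at this
          have hval : (((t : ℝ) ^ 3)⁻¹ • ∫ r in (0 : ℝ)..t, r ^ 3 • IccExtend hT f r) = 0 := by
            rw [← h0]; simp
          rw [ContinuousAt, hval]
          exact squeeze_zero_norm (fun r => norm_dampedMean_le hT f r.2.1) hlim
        · exact ((continuous_subtype_val.pow 3).continuousAt.inv₀ (pow_pos hpos 3).ne').smul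
            hprim.continuousAt }
  map_add' f h := by
    ext t
    have : ∀ r, IccExtend hT (f + h) r = IccExtend hT f r + IccExtend hT h r := fun _ => rfl
    simp only [ContinuousMap.coe_mk, ContinuousMap.add_apply, this, smul_add]
    rw [intervalIntegral.integral_add ((continuous_cube_smul_extend hT f).intervalIntegrable _ _)
      ((continuous_cube_smul_extend hT h).intervalIntegrable _ _), smul_add]
  map_smul' c f := by
    ext t
    have : ∀ r, r ^ 3 • IccExtend hT (c • f) r = c • r ^ 3 • IccExtend hT f r :=
      fun r => smul_comm _ _ _
    simp only [ContinuousMap.coe_mk, ContinuousMap.smul_apply, this, RingHom.id_apply]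
    rw [intervalIntegral.integral_smul, smul_comm]

theorem dampedMean_apply (hT : 0 ≤ T) (f : PathSpace T F) (t : Icc (0 : ℝ) T) :
    dampedMean hT f t = ((t : ℝ) ^ 3)⁻¹ • ∫ r in (0 : ℝ)..t, r ^ 3 • IccExtend hT f r := rfl

/-- Product rule: differentiating `t⁻³` produces the damping term, and differentiating the integral
gives `t³ f(t)`, whose weight cancels. -/
theorem hasDerivWithinAt_dampedMean [CompleteSpace F] (hT : 0 ≤ T) (f : PathSpace T F)
    (t : Icc (0 : ℝ) T) (ht : 0 < (t : ℝ)) :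
    HasDerivWithinAt (IccExtend hT (dampedMean hT f)) (f t - (3 / (t : ℝ)) • dampedMean hT f t)
      (Icc 0 T) t := by
  have h1 := ((continuous_cube_smul_extend hT f).integral_hasStrictDerivAt 0 t).hasDerivAt
  rw [PathSpace.extend_apply] at h1
  have h2 : HasDerivAt (fun r : ℝ => (r ^ 3)⁻¹) (-(3 / (t : ℝ)) * ((t : ℝ) ^ 3)⁻¹) t := by
    refine ((hasDerivAt_pow 3 (t : ℝ)).fun_inv (pow_pos ht 3).ne').congr_deriv ?_
    field_simp
    norm_num [mul_comm]
  have h3 := (h2.smul h1).hasDerivWithinAt (s := Icc 0 T)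
  refine PathSpace.hasDerivWithinAt_extend hT (HasDerivWithinAt.congr_deriv h3 ?_) fun r => rfl
  rw [dampedMean_apply, smul_smul, smul_smul, inv_mul_cancel₀ (by positivity), one_smul, neg_mul,
    neg_smul, sub_eq_add_neg]

/-- The linear map that sends a forcing term `f` to the solution of the initial value problem
with right-hand side `-f` and zero initial values. -/
noncomputable def Scheme.forcingMap (s : Scheme) (hT : 0 ≤ T) : PathSpace T F →ₗ[ℝ] PathSpace T F :=
  match s with
  | .plain => -pathPrimitive hT
  | .accelerated => -(pathPrimitive hT ∘ₗ dampedMean hT)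

/-- Keeping the integral up to `t`, instead of a supremum over `[0,T]`, is what permits Grönwall and
the factorial decay of iterates. The factor is `1` in the plain case; the outer integration costs
`T` in the accelerated one. -/
theorem Scheme.norm_forcingMap_apply_le (s : Scheme) (hT : 0 ≤ T) (f : PathSpace T F)
    (t : Icc (0 : ℝ) T) :
    ‖s.forcingMap hT f t‖ ≤ max 1 T * ∫ r in (0 : ℝ)..t, ‖IccExtend hT f r‖ := by
  have hint : 0 ≤ ∫ r in (0 : ℝ)..t, ‖IccExtend hT f r‖ :=
    intervalIntegral.integral_nonneg t.2.1 fun _ _ => norm_nonneg _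
  cases s with
  | plain =>
    change ‖-pathPrimitive hT f t‖ ≤ _
    rw [norm_neg]
    refine (norm_pathPrimitive_le hT f t).trans ?_
    exact le_mul_of_one_le_left hint (le_max_left _ _)
  | accelerated =>
    change ‖-pathPrimitive hT (dampedMean hT f) t‖ ≤ _
    rw [norm_neg]
    calc ‖pathPrimitive hT (dampedMean hT f) t‖
        ≤ (∫ u in (0 : ℝ)..t, ‖IccExtend hT f u‖) * |(t : ℝ) - 0| := by
          refine intervalIntegral.norm_integral_le_of_norm_le_const fun r hr => ?_
          rw [uIoc_of_le t.2.1] at hr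
          have hr' : r ∈ Icc (0 : ℝ) T := ⟨hr.1.le, hr.2.trans t.2.2⟩
          rw [IccExtend_of_mem hT _ hr']
          exact (norm_dampedMean_le hT f hr.1.le).trans
            (integral_norm_extend_mono hT f hr.1.le hr.2)
      _ ≤ max 1 T * ∫ r in (0 : ℝ)..t, ‖IccExtend hT f r‖ := by
          rw [sub_zero, abs_of_nonneg t.2.1, mul_comm]
          gcongr
          exact t.2.2.trans (le_max_right _ _)

/-- A path with vanishing derivative is constant. -/
theorem PathSpace.eq_of_hasDerivWithinAt_zero (hT : 0 ≤ T) {f : PathSpace T F}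
    (h : ∀ t : Icc (0 : ℝ) T, 0 < (t : ℝ) → HasDerivWithinAt (IccExtend hT f) 0 (Icc 0 T) t)
    (t : Icc (0 : ℝ) T) : f t = f ⟨0, left_mem_Icc.mpr hT⟩ := by
  -- The derivative is known at positive times only, so constancy is shown on `[a,t]` and then `a`
  -- decreases to `0`.
  have hconst : ∀ a ∈ Ioc 0 (t : ℝ), IccExtend hT f t = IccExtend hT f a := by
    intro a ha
    refine constant_of_has_deriv_right_zero (a := a) (b := t)
      (f.continuous_extend hT).continuousOn (fun r hr => ?_) t ⟨ha.2, le_rfl⟩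
    have hrI : r ∈ Icc (0 : ℝ) T := ⟨ha.1.le.trans hr.1, hr.2.le.trans t.2.2⟩
    refine (h ⟨r, hrI⟩ (ha.1.trans_le hr.1)).mono_of_mem_nhdsWithin ?_
    exact mem_of_superset (Icc_mem_nhdsGE (hr.2.trans_le t.2.2))
      (Icc_subset_Icc_left hrI.1)
  rcases t.2.1.eq_or_lt with h0 | hpos
  · congr 1
    exact Subtype.ext h0.symm
  · have hlim : Tendsto (IccExtend hT f) (𝓝[>] 0) (𝓝 (IccExtend hT f 0)) :=
      ((f.continuous_extend hT).tendsto 0).mono_left nhdsWithin_le_nhds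
    have hlim' : Tendsto (IccExtend hT f) (𝓝[>] 0) (𝓝 (IccExtend hT f t)) := by
      refine tendsto_const_nhds.congr' ?_
      filter_upwards [Ioc_mem_nhdsGT hpos] with a ha using hconst a ha
    have := tendsto_nhds_unique hlim' hlim
    rwa [PathSpace.extend_apply, IccExtend_of_mem hT f (left_mem_Icc.mpr hT)] at this

theorem Scheme.solves_forcingMap [CompleteSpace F] (s : Scheme) (hT : 0 ≤ T) (f : PathSpace T F)
    (x₀ : F) :
    s.Solves hT (fun t _ => f t) x₀ (ContinuousMap.const _ x₀ + s.forcingMap hT f) := by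
  cases s with
  | plain =>
    refine ⟨?_, fun t => ?_⟩
    · change x₀ + -pathPrimitive hT f _ = x₀
      simp [pathPrimitive_apply]
    · refine PathSpace.hasDerivWithinAt_extend hT
        ((hasDerivWithinAt_pathPrimitive hT f t).neg.const_add x₀) fun r => ?_
      change x₀ + -pathPrimitive hT f _ = x₀ + -IccExtend hT (pathPrimitive hT f) r
      rw [PathSpace.extend_apply]
  | accelerated =>
    refine ⟨-dampedMean hT f, ?_, ?_, fun t => ?_, fun t ht => ?_⟩
    · change x₀ + -pathPrimitive hT (dampedMean hT f) _ = x₀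
      simp [pathPrimitive_apply]
    · simp [dampedMean_apply]
    · refine PathSpace.hasDerivWithinAt_extend hT
        ((hasDerivWithinAt_pathPrimitive hT (dampedMean hT f) t).neg.const_add x₀) fun r => ?_
      change x₀ + -pathPrimitive hT (dampedMean hT f) _ =
        x₀ + -IccExtend hT (pathPrimitive hT (dampedMean hT f)) r
      rw [PathSpace.extend_apply]
    · refine PathSpace.hasDerivWithinAt_extend hT
        ((hasDerivWithinAt_dampedMean hT f t ht).neg.congr_deriv ?_) fun r => ?_
      · rw [ContinuousMap.neg_apply, smul_neg]
        abel
      · change -dampedMean hT f r = -IccExtend hT (dampedMean hT f) r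
        rw [PathSpace.extend_apply]

/-- In the accelerated case the difference `d` of the velocities satisfies `d' = -(3/t) d`, so `t³
d` has zero derivative and vanishes at `0`. Equal velocities and equal initial points then give
equal paths. -/
theorem Scheme.solves_unique_of_forcing (s : Scheme) (hT : 0 ≤ T) {f : PathSpace T F}
    {x₀ : F} {x y : PathSpace T F} (hx : s.Solves hT (fun t _ => f t) x₀ x)
    (hy : s.Solves hT (fun t _ => f t) x₀ y) : x = y := by
  have key : ∀ {x y : PathSpace T F}, x ⟨0, left_mem_Icc.mpr hT⟩ = y ⟨0, left_mem_Icc.mpr hT⟩ →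
      (∀ t : Icc (0 : ℝ) T, 0 < (t : ℝ) → ∃ d, HasDerivWithinAt (IccExtend hT x) d (Icc 0 T) t ∧
        HasDerivWithinAt (IccExtend hT y) d (Icc 0 T) t) → x = y := by
    intro x y h0 hd
    ext t
    rw [← sub_eq_zero]
    have := PathSpace.eq_of_hasDerivWithinAt_zero hT (f := x - y) (fun t ht => ?_) t
    · rwa [ContinuousMap.sub_apply, ContinuousMap.sub_apply, h0, sub_self] at this
    · obtain ⟨d, h1, h2⟩ := hd t ht
      have := h1.sub h2
      rw [sub_self] at this
      exact this
  cases s with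
  | plain => exact key (hx.1.trans hy.1.symm) fun t _ => ⟨_, hx.2 t, hy.2 t⟩
  | accelerated =>
    obtain ⟨x', hx0, hx0', hx1, hx2⟩ := hx
    obtain ⟨y', hy0, hy0', hy1, hy2⟩ := hy
    suffices hxy : x' = y' by
      subst hxy
      exact key (hx0.trans hy0.symm) fun t _ => ⟨_, hx1 t, hy1 t⟩
    let d : PathSpace T F := ⟨fun t => (t : ℝ) ^ 3 • (x' t - y' t),
      (continuous_subtype_val.pow 3).smul (x'.continuous.sub y'.continuous)⟩
    have hd : ∀ t, d t = 0 := by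
      intro t
      have h0 : d ⟨0, left_mem_Icc.mpr hT⟩ = 0 := by simp [d]
      rw [← h0]
      refine PathSpace.eq_of_hasDerivWithinAt_zero hT (fun t ht => ?_) t
      have h1 := ((hasDerivAt_pow 3 (t : ℝ)).hasDerivWithinAt (s := Icc 0 T)).smul
        ((hx2 t ht).sub (hy2 t ht))
      refine PathSpace.hasDerivWithinAt_extend hT (HasDerivWithinAt.congr_deriv h1 ?_)
        fun r => ?_
      · simp only [Pi.sub_apply, PathSpace.extend_apply]
        have : -((3 / (t : ℝ)) • x' t + f t) - -((3 / (t : ℝ)) • y' t + f t) =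
            -((3 / (t : ℝ)) • (x' t - y' t)) := by
          rw [smul_sub]; abel
        rw [this, smul_neg, smul_smul]
        have h3 : (t : ℝ) ^ 3 * (3 / (t : ℝ)) = ((3 : ℕ) : ℝ) * (t : ℝ) ^ (3 - 1) := by
          field_simp
          norm_num [mul_comm]
        rw [h3, neg_add_cancel]
      · simp only [Pi.sub_apply, PathSpace.extend_apply, d, ContinuousMap.coe_mk,
          Pi.smul_apply']
    ext t
    rcases t.2.1.eq_or_lt with h0 | hpos
    · have : t = ⟨0, left_mem_Icc.mpr hT⟩ := Subtype.ext h0.symm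
      rw [this, hx0', hy0']
    · have := hd t
      simp only [d, ContinuousMap.coe_mk] at this
      exact sub_eq_zero.mp ((smul_eq_zero.mp this).resolve_left (by positivity))

/-- The initial value problem as an integral equation. -/
theorem Scheme.solves_iff_eq_forcingMap [CompleteSpace F] (s : Scheme) (hT : 0 ≤ T)
    {b : Icc (0 : ℝ) T → F → F} {x₀ : F} {x : PathSpace T F} (f : PathSpace T F)
    (hf : ∀ t, f t = b t (x t)) :
    s.Solves hT b x₀ x ↔ x = ContinuousMap.const _ x₀ + s.forcingMap hT f := by
  -- The vector field enters only through its values along `x`, so it may be frozen to the forcing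
  -- `f`.
  have hb : s.Solves hT b x₀ x ↔ s.Solves hT (fun t _ => f t) x₀ x := by
    simp_rw [hf]
    cases s <;> rfl
  rw [hb]
  exact ⟨fun h => s.solves_unique_of_forcing hT h (s.solves_forcingMap hT f x₀),
    fun h => h ▸ s.solves_forcingMap hT f x₀⟩

/-- Continuous linear maps commute with differentiation. The intended map is evaluation of a matrix
at a fixed vector. -/
theorem Scheme.Solves.map_clm {G : Type*} [NormedAddCommGroup G] [NormedSpace ℝ G] {s : Scheme}
    {hT : 0 ≤ T} {b : Icc (0 : ℝ) T → F → F} {b' : Icc (0 : ℝ) T → G → G} {x₀ : F}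
    {x : PathSpace T F} (h : s.Solves hT b x₀ x) (Λ : F →L[ℝ] G)
    (hb : ∀ t y, Λ (b t y) = b' t (Λ y)) :
    s.Solves hT b' (Λ x₀) ((Λ : C(F, G)).comp x) := by
  have key : ∀ {y : PathSpace T F} {d : F} {t : Icc (0 : ℝ) T},
      HasDerivWithinAt (IccExtend hT y) d (Icc 0 T) t →
      HasDerivWithinAt (IccExtend hT ((Λ : C(F, G)).comp y)) (Λ d) (Icc 0 T) t := fun hy =>
    Λ.hasFDerivAt.comp_hasDerivWithinAt _ hy
  cases s with
  | plain =>
    refine ⟨congrArg Λ h.1, fun t => (key (h.2 t)).congr_deriv ?_⟩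
    rw [map_neg, hb]
    rfl
  | accelerated =>
    obtain ⟨x', h0, h0', h1, h2⟩ := h
    refine ⟨(Λ : C(F, G)).comp x', congrArg Λ h0, (congrArg Λ h0').trans (map_zero Λ),
      fun t => key (h1 t), fun t ht => (key (h2 t ht)).congr_deriv ?_⟩
    rw [map_neg, map_add, map_smul, hb]
    rfl

end SolutionOperators

/-! ### Linear equations with continuous coefficients -/

section LinearEquations

variable {F : Type*} [NormedAddCommGroup F] {T : ℝ}

theorem integral_norm_extend_le (hT : 0 ≤ T) (f : PathSpace T F) {φ : ℝ → ℝ} (hφ : Continuous φ)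
    (h : ∀ t, ‖f t‖ ≤ φ t) (t : Icc (0 : ℝ) T) :
    ∫ r in (0 : ℝ)..t, ‖IccExtend hT f r‖ ≤ ∫ r in (0 : ℝ)..t, φ r := by
  refine intervalIntegral.integral_mono_on t.2.1
    ((f.continuous_extend hT).norm.intervalIntegrable _ _) (hφ.intervalIntegrable _ _) ?_
  intro r hr
  have hrT : r ∈ Icc (0 : ℝ) T := ⟨hr.1, hr.2.trans t.2.2⟩
  rw [IccExtend_of_mem hT f hrT]
  exact h ⟨r, hrT⟩

/-- The integral form of the Grönwall inequality. -/
theorem PathSpace.norm_le_of_integral_le (hT : 0 ≤ T) {f : PathSpace T F} {a K : ℝ} (ha : 0 ≤ a)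
    (hK : 0 ≤ K) (h : ∀ t, ‖f t‖ ≤ a + K * ∫ r in (0 : ℝ)..t, ‖IccExtend hT f r‖)
    (t : Icc (0 : ℝ) T) : ‖f t‖ ≤ a * Real.exp (K * T) := by
  have hc : Continuous fun r => ‖IccExtend hT f r‖ := (f.continuous_extend hT).norm
  -- The differential Grönwall inequality is applied to the primitive `w` of `‖f‖`, for which `w' ≤
  -- K w + a` and `w(0) = 0`.
  have hw := norm_le_gronwallBound_of_norm_deriv_right_le
    (f := fun t : ℝ => ∫ r in (0 : ℝ)..t, ‖IccExtend hT f r‖)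
    (f' := fun t => ‖IccExtend hT f t‖) (δ := 0) (K := K) (ε := a) (a := 0) (b := T)
    (intervalIntegral.continuous_primitive (fun a b => hc.intervalIntegrable a b) 0).continuousOn
    (fun x _ => (hc.integral_hasStrictDerivAt 0 x).hasDerivAt.hasDerivWithinAt) (by simp)
    (fun x hx => by
      have hxT : x ∈ Icc (0 : ℝ) T := Ico_subset_Icc_self hx
      rw [Real.norm_of_nonneg (norm_nonneg _), Real.norm_of_nonneg
        (intervalIntegral.integral_nonneg hx.1 fun _ _ => norm_nonneg _),
        IccExtend_of_mem hT f hxT, add_comm]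
      exact h ⟨x, hxT⟩) t t.2
  rw [sub_zero] at hw
  have hw' := (le_abs_self _).trans hw
  calc ‖f t‖ ≤ a + K * gronwallBound 0 K a t := (h t).trans (by gcongr)
    _ = a * Real.exp (K * t) := by
      rcases eq_or_ne K 0 with rfl | hK0
      · simp
      · rw [gronwallBound_of_K_ne_0 hK0]
        field_simp
        ring
    _ ≤ a * Real.exp (K * T) := by
      gcongr
      exact t.2.2

variable [NormedSpace ℝ F]

/-- `Scheme.forcingMap` as a continuous linear map. -/
noncomputable def Scheme.forcingCLM (s : Scheme) (hT : 0 ≤ T) :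
    PathSpace T F →L[ℝ] PathSpace T F :=
  (s.forcingMap hT).mkContinuous (max 1 T * T) fun f => by
    have : 0 ≤ max 1 T := zero_le_one.trans (le_max_left _ _)
    rw [ContinuousMap.norm_le _ (by positivity)]
    intro t
    refine (s.norm_forcingMap_apply_le hT f t).trans ?_
    rw [mul_assoc]
    gcongr
    refine (integral_norm_extend_le hT f continuous_const f.norm_coe_le_norm t).trans ?_
    rw [intervalIntegral.integral_const, sub_zero, smul_eq_mul]
    gcongr
    exact t.2.2

theorem Scheme.norm_forcingCLM_apply_le (s : Scheme) (hT : 0 ≤ T) (f : PathSpace T F)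
    (t : Icc (0 : ℝ) T) :
    ‖s.forcingCLM hT f t‖ ≤ max 1 T * ∫ r in (0 : ℝ)..t, ‖IccExtend hT f r‖ :=
  s.norm_forcingMap_apply_le hT f t

/-- Pointwise application of a path of operators to a path of vectors. -/
noncomputable def PathSpace.applyCLM (A : PathSpace T (F →L[ℝ] F)) :
    PathSpace T F →L[ℝ] PathSpace T F :=
  LinearMap.mkContinuous
    { toFun := fun v => ⟨fun t => A t (v t), A.continuous.clm_apply v.continuous⟩
      map_add' := fun v w => by ext t; simp
      map_smul' := fun c v => by ext t; simp } ‖A‖ fun v => by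
    rw [ContinuousMap.norm_le _ (by positivity)]
    intro t
    exact ((A t).le_opNorm _).trans (mul_le_mul (A.norm_coe_le_norm t) (v.norm_coe_le_norm t)
      (norm_nonneg _) (norm_nonneg A))

/-- `1 - B` is invertible if the norms of the iterates of `B` are summable. -/
theorem exists_resolvent_of_summable_iterates {E : Type*} [NormedAddCommGroup E] [NormedSpace ℝ E]
    [CompleteSpace E] (B : E →L[ℝ] E) {c : ℕ → ℝ} (hc : Summable c)
    (h : ∀ n v, ‖B^[n] v‖ ≤ c n * ‖v‖) :
    ∃ R : E →L[ℝ] E, ∀ u v, u = v + B u ↔ u = R v := by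
  -- The Neumann series converges in operator norm although `‖B‖` need not be below `1`.
  have hsum : Summable fun n : ℕ => B ^ n := by
    refine Summable.of_norm_bounded hc.abs
      fun n => ContinuousLinearMap.opNorm_le_bound _ (abs_nonneg _) fun v => ?_
    rw [FunLike.coe_pow_eq_iterate]
    exact (h n v).trans (by gcongr; exact le_abs_self _)
  refine ⟨∑' n, B ^ n, fun u v => ?_⟩
  have h1 : ∀ w : E, (∑' n, B ^ n) w - B ((∑' n, B ^ n) w) = w := fun w => by
    simpa using congrArg (fun S : E →L[ℝ] E => S w) hsum.one_sub_mul_tsum_pow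
  have h2 : ∀ w : E, (∑' n, B ^ n) (w - B w) = w := fun w => by
    simpa using congrArg (fun S : E →L[ℝ] E => S w) hsum.tsum_pow_mul_one_sub
  constructor
  · intro h
    rw [← h2 u, sub_eq_iff_eq_add.mpr h]
  · rintro rfl
    exact sub_eq_iff_eq_add.mp (h1 v)

/-- Each application integrates the previous pointwise bound from `0` to `t`, turning `tⁿ/n!` into
`tⁿ⁺¹/(n+1)!`. -/
theorem Scheme.norm_forcingCLM_comp_pow_apply_le (s : Scheme) (hT : 0 ≤ T)
    (A : PathSpace T (F →L[ℝ] F)) (n : ℕ) (v : PathSpace T F) (t : Icc (0 : ℝ) T) :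
    ‖((s.forcingCLM hT ∘L PathSpace.applyCLM A)^[n]) v t‖ ≤
      (max 1 T * ‖A‖ * t) ^ n / n.factorial * ‖v‖ := by
  have hmax : 0 ≤ max 1 T := zero_le_one.trans (le_max_left _ _)
  induction n generalizing t with
  | zero => simpa using v.norm_coe_le_norm t
  | succ n ih =>
    rw [Function.iterate_succ_apply']
    set w := ((s.forcingCLM hT ∘L PathSpace.applyCLM A)^[n]) v
    have hφ : Continuous fun r : ℝ =>
        ‖A‖ * ((max 1 T * ‖A‖ * r) ^ n / n.factorial * ‖v‖) := by fun_prop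
    calc ‖s.forcingCLM hT (PathSpace.applyCLM A w) t‖
        ≤ max 1 T * ∫ r in (0 : ℝ)..t, ‖IccExtend hT (PathSpace.applyCLM A w) r‖ :=
          s.norm_forcingCLM_apply_le hT _ t
      _ ≤ max 1 T * ∫ r in (0 : ℝ)..t, ‖A‖ * ((max 1 T * ‖A‖ * r) ^ n / n.factorial * ‖v‖) := by
          gcongr
          refine integral_norm_extend_le hT _ hφ (fun r => ?_) t
          exact ((A r).le_opNorm _).trans
            (mul_le_mul (A.norm_coe_le_norm r) (ih r) (norm_nonneg _) (norm_nonneg A))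
      _ = (max 1 T * ‖A‖ * t) ^ (n + 1) / (n + 1).factorial * ‖v‖ := by
          have : ∀ r : ℝ, ‖A‖ * ((max 1 T * ‖A‖ * r) ^ n / n.factorial * ‖v‖) =
              (‖A‖ * (max 1 T * ‖A‖) ^ n / n.factorial * ‖v‖) * r ^ n := fun r => by ring
          simp_rw [this]
          rw [intervalIntegral.integral_const_mul, integral_pow, Nat.factorial_succ]
          push_cast
          field_simp
          ring

/-- The resolvent of the Volterra operator `u ↦ s.forcingCLM hT (A u)`. -/
theorem Scheme.exists_resolvent [CompleteSpace F] (s : Scheme) (hT : 0 ≤ T)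
    (A : PathSpace T (F →L[ℝ] F)) :
    ∃ R : PathSpace T F →L[ℝ] PathSpace T F, ∀ u v : PathSpace T F,
      u = v + s.forcingCLM hT (PathSpace.applyCLM A u) ↔ u = R v := by
  refine exists_resolvent_of_summable_iterates (s.forcingCLM hT ∘L PathSpace.applyCLM A)
    (Real.summable_pow_div_factorial (max 1 T * ‖A‖ * T)) fun n v => ?_
  have hmax : 0 ≤ max 1 T := zero_le_one.trans (le_max_left _ _)
  have hA : 0 ≤ ‖A‖ := norm_nonneg A
  rw [ContinuousMap.norm_le _ (by positivity)]
  intro t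
  refine (s.norm_forcingCLM_comp_pow_apply_le hT A n v t).trans ?_
  have ht0 := t.2.1
  gcongr
  exact t.2.2

/-- Existence, uniqueness and stability for the linear initial value problems. -/
theorem Scheme.exists_linear_solution [CompleteSpace F] (s : Scheme) (hT : 0 ≤ T)
    (A : PathSpace T (F →L[ℝ] F)) :
    ∃ Φ : PathSpace T F →L[ℝ] PathSpace T F,
      (∀ f x : PathSpace T F, s.Solves hT (fun t y => A t y + f t) 0 x ↔ x = Φ f) ∧
      ∃ C : ℝ, 0 ≤ C ∧ ∀ (f β x : PathSpace T F) (x₀ : F),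
        x = ContinuousMap.const _ x₀ + s.forcingCLM hT β →
        ‖x - Φ f‖ ≤ C * (‖x₀‖ + ‖β - (PathSpace.applyCLM A x + f)‖) := by
  obtain ⟨R, hR⟩ := s.exists_resolvent hT A
  refine ⟨R ∘L s.forcingCLM hT, fun f x => ?_,
    ‖R‖ * (1 + ‖s.forcingCLM (F := F) hT‖), by positivity, fun f β x x₀ hx => ?_⟩
  · rw [s.solves_iff_eq_forcingMap (b := fun t y => A t y + f t) hT
      (PathSpace.applyCLM A x + f) (fun t => rfl), ContinuousLinearMap.comp_apply, ← hR]
    change x = 0 + s.forcingCLM hT (PathSpace.applyCLM A x + f) ↔ _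
    rw [map_add, zero_add, add_comm]
  -- `E` is the defect of `x` in the linear equation. Since `β = E + f + A x`, the resolvent gives
  -- `x - Φ f = R (x₀ + S E)`.
  · set E : PathSpace T F := β - (PathSpace.applyCLM A x + f) with hE
    have hxR : x = R (ContinuousMap.const _ x₀ + s.forcingCLM hT (E + f)) := by
      rw [← hR, add_assoc, ← map_add]
      have : E + f + PathSpace.applyCLM A x = β := by rw [hE]; abel
      rw [this]
      exact hx
    have hsub : x - (R ∘L s.forcingCLM hT) f =
        R (ContinuousMap.const _ x₀ + s.forcingCLM hT E) := by
      rw [ContinuousLinearMap.comp_apply]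
      nth_rewrite 1 [hxR]
      rw [← map_sub, map_add]
      congr 1
      abel
    have hconst : ‖(ContinuousMap.const _ x₀ : PathSpace T F)‖ ≤ ‖x₀‖ :=
      (ContinuousMap.norm_le _ (norm_nonneg _)).mpr fun _ => le_rfl
    rw [hsub, mul_assoc]
    refine (R.le_opNorm _).trans (mul_le_mul_of_nonneg_left ?_ (norm_nonneg R))
    have h0 : 0 ≤ ‖s.forcingCLM (F := F) hT‖ :=
      norm_nonneg (s.forcingCLM (F := F) hT)
    have h1 : 0 ≤ ‖E‖ := norm_nonneg E
    calc ‖(ContinuousMap.const _ x₀ : PathSpace T F) + s.forcingCLM hT E‖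
        ≤ ‖x₀‖ + ‖s.forcingCLM (F := F) hT‖ * ‖E‖ :=
          (norm_add_le _ _).trans (add_le_add hconst ((s.forcingCLM hT).le_opNorm E))
      _ ≤ (1 + ‖s.forcingCLM (F := F) hT‖) * (‖x₀‖ + ‖E‖) := by
          nlinarith [norm_nonneg x₀]

end LinearEquations

/-! ### Gradients and Hessians -/

section Gradients

variable {p : ℕ} {𝒰 : Type*}

theorem gradient_empiricalLoss {ℓ : Euc p → 𝒰 → ℝ} {n : ℕ} (u : Fin n → 𝒰) {θ : Euc p}
    (h : ∀ i, DifferentiableAt ℝ (fun η => ℓ η (u i)) θ) :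
    ∇ (empiricalLoss ℓ u) θ = (n : ℝ)⁻¹ • ∑ i, ∇ (fun η => ℓ η (u i)) θ := by
  have h1 : HasFDerivAt (empiricalLoss ℓ u)
      ((n : ℝ)⁻¹ • ∑ i, fderiv ℝ (fun η => ℓ η (u i)) θ) θ :=
    (HasFDerivAt.fun_sum fun i _ => (h i).hasFDerivAt).const_mul _
  simp only [gradient, h1.fderiv, map_smul, map_sum]

/-- Termwise triangle inequality. Absolute values make the Lipschitz constant nonnegative, as the
Grönwall estimate requires. -/
theorem norm_gradient_empiricalLoss_sub_le {ℓ : Euc p → 𝒰 → ℝ} {h₁ : 𝒰 → ℝ} {Θ : Set (Euc p)}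
    (hdiff : ∀ u, ∀ θ ∈ Θ, ContDiffAt ℝ 2 (fun η => ℓ η u) θ)
    (hlip : ∀ u, ∀ θ ∈ Θ, ∀ ϑ ∈ Θ,
      ‖∇ (fun η => ℓ η u) θ - ∇ (fun η => ℓ η u) ϑ‖ ≤ h₁ u * ‖θ - ϑ‖)
    {n : ℕ} (u : Fin n → 𝒰) {θ ϑ : Euc p} (hθ : θ ∈ Θ) (hϑ : ϑ ∈ Θ) :
    ‖∇ (empiricalLoss ℓ u) θ - ∇ (empiricalLoss ℓ u) ϑ‖ ≤
      ((n : ℝ)⁻¹ * ∑ i, |h₁ (u i)|) * ‖θ - ϑ‖ := by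
  have hd : ∀ θ ∈ Θ, ∀ i, DifferentiableAt ℝ (fun η => ℓ η (u i)) θ := fun θ hθ i =>
    (hdiff (u i) θ hθ).differentiableAt (by norm_num)
  rw [gradient_empiricalLoss u (hd θ hθ), gradient_empiricalLoss u (hd ϑ hϑ), ← smul_sub,
    ← Finset.sum_sub_distrib, norm_smul, Real.norm_of_nonneg (by positivity), mul_assoc,
    Finset.sum_mul]
  gcongr
  refine norm_sum_le_of_le _ fun i _ => (hlip (u i) θ hθ ϑ hϑ).trans ?_
  gcongr
  exact le_abs_self _

theorem contDiffAt_gradient {g : Euc p → ℝ} {θ : Euc p} (h : ContDiffAt ℝ 2 g θ) :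
    ContDiffAt ℝ 1 (∇ g) θ :=
  ((InnerProductSpace.toDual ℝ (Euc p)).symm.contDiff.contDiffAt (x := fderiv ℝ g θ)).comp θ
    (h.fderiv_right (m := 1) (by norm_num))

/-- This links the matrix equations to the derivative of `∇ g` that appears in the Taylor expansion.
-/
theorem toEuclideanCLM_hessianMatrix (g : Euc p → ℝ) (θ : Euc p) :
    Matrix.toEuclideanCLM (𝕜 := ℝ) (hessianMatrix g θ) = fderiv ℝ (∇ g) θ := by
  apply ContinuousLinearMap.coe_injective
  refine (EuclideanSpace.basisFun (Fin p) ℝ).toBasis.ext fun j => ?_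
  ext i
  simp [hessianMatrix, Matrix.ofLp_toEuclideanCLM]

theorem continuous_fderiv_gradient_comp {S : Type*} [TopologicalSpace S] {g : Euc p → ℝ}
    {x : S → Euc p} (hx : Continuous x) (hg : ∀ t, ContDiffAt ℝ 2 g (x t)) :
    Continuous fun t => fderiv ℝ (∇ g) (x t) := by
  rw [continuous_iff_continuousAt]
  intro t
  exact ContinuousAt.comp (g := fderiv ℝ (∇ g)) (f := x)
    ((contDiffAt_gradient (hg t)).continuousAt_fderiv (by norm_num)) hx.continuousAt

theorem continuous_hessianMatrix_comp {S : Type*} [TopologicalSpace S] {g : Euc p → ℝ}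
    {x : S → Euc p} (hx : Continuous x) (hg : ∀ t, ContDiffAt ℝ 2 g (x t)) :
    Continuous fun t => hessianMatrix g (x t) := by
  refine continuous_matrix fun i j => ?_
  have := (continuous_fderiv_gradient_comp hx hg).clm_apply
    (continuous_const (y := EuclideanSpace.single j (1 : ℝ)))
  exact (PiLp.continuous_apply 2 _ i).comp this

/-- A function that is continuously differentiable near a compact set is uniformly differentiable
on it. -/
theorem IsCompact.exists_forall_norm_sub_sub_fderiv_le {E F : Type*} [NormedAddCommGroup E]
    [NormedSpace ℝ E] [NormedAddCommGroup F] [NormedSpace ℝ F] {K : Set E} (hK : IsCompact K)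
    {f : E → F} (hf : ∀ x ∈ K, ContDiffAt ℝ 1 f x) {ε : ℝ} (hε : 0 < ε) :
    ∃ δ > 0, ∀ x ∈ K, ∀ y, ‖y - x‖ ≤ δ → ‖f y - f x - fderiv ℝ f x (y - x)‖ ≤ ε * ‖y - x‖ := by
  have hev : ∀ᶠ v in 𝓝 (0 : E), ∀ x ∈ K,
      ‖f (x + v) - f x - fderiv ℝ f x v‖ ≤ ε * ‖v‖ := by
    -- By compactness a joint estimate near `(0, x)` suffices: strict differentiability at `x`
    -- controls the error with the derivative at `x`, and continuity of the derivative moves it to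
    -- the base point `y`.
    refine hK.eventually_forall_of_forall_eventually fun x hx => ?_
    have hstrict := ((hf x hx).hasStrictFDerivAt (by norm_num)).isLittleO.def (half_pos hε)
    have hcont : ∀ᶠ y in 𝓝 x, ‖fderiv ℝ f y - fderiv ℝ f x‖ < ε / 2 := by
      have := ((hf x hx).continuousAt_fderiv (by norm_num)).eventually
        (Metric.ball_mem_nhds _ (half_pos hε))
      simpa only [dist_eq_norm, Metric.mem_ball] using this
    have ht1 : Tendsto (fun z : E × E => (z.2 + z.1, z.2)) (𝓝 (0, x)) (𝓝 (x, x)) := by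
      have : Continuous fun z : E × E => (z.2 + z.1, z.2) := by fun_prop
      simpa using this.tendsto (0, x)
    have ht2 : Tendsto (fun z : E × E => z.2) (𝓝 (0, x)) (𝓝 x) := continuous_snd.tendsto (0, x)
    filter_upwards [ht1.eventually hstrict, ht2.eventually hcont] with ⟨v, y⟩ h1 h2
    simp only [add_sub_cancel_left] at h1 h2
    calc ‖f (y + v) - f y - fderiv ℝ f y v‖
        = ‖(f (y + v) - f y - fderiv ℝ f x v) - (fderiv ℝ f y - fderiv ℝ f x) v‖ := by
          rw [sub_apply]; congr 1; abel
      _ ≤ ε / 2 * ‖v‖ + ε / 2 * ‖v‖ := (norm_sub_le _ _).trans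
          (add_le_add h1 (((fderiv ℝ f y - fderiv ℝ f x).le_opNorm v).trans (by gcongr)))
      _ = ε * ‖v‖ := by ring
  obtain ⟨δ, hδ, h⟩ := Metric.eventually_nhds_iff_ball.mp hev
  -- Halving passes from an open ball to the closed condition `≤`.
  refine ⟨δ / 2, half_pos hδ, fun x hx y hy => ?_⟩
  have := h (y - x) (by simpa using hy.trans_lt (half_lt_self hδ)) x hx
  simpa using this

theorem continuous_sigmaMatrix_comp [MeasurableSpace 𝒰] {Q : Measure 𝒰} {Θ : Set (Euc p)}
    {ℓ : Euc p → 𝒰 → ℝ} (h : CovarianceRegularity Q Θ ℓ) {S : Type*} [TopologicalSpace S]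
    {x : S → Euc p} (hx : Continuous x) (hmem : ∀ t, x t ∈ Θ) :
    Continuous fun t => sigmaMatrix ℓ Q (x t) := by
  have hc : Continuous fun t => crossCov ℓ Q (x t) (x t) := continuous_matrix fun i j =>
    (h.contDiff i j).continuousOn.comp_continuous (hx.prodMk hx) fun t => ⟨hmem t, hmem t⟩
  exact CFC.continuousOn_sqrt.comp_continuous hc fun t =>
    Matrix.nonneg_iff_posSemidef.mpr (h.posDef _ (hmem t)).posSemidef

end Gradients

/-! ### Convergence in distribution on varying probability spaces -/

section Convergence

variable {Ω : ℕ → Type*} [∀ n, MeasurableSpace (Ω n)] {P : ∀ n, Measure (Ω n)}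
  [∀ n, IsProbabilityMeasure (P n)] {Ω' : Type*} [MeasurableSpace Ω'] {P' : Measure Ω'}
  [IsProbabilityMeasure P']

/-- Slutsky's theorem: a perturbation that vanishes in probability does not change the limit in
distribution. -/
theorem MeasureTheory.TendstoInDistribution.of_norm_sub_tendsto_zero {E : Type*}
    [NormedAddCommGroup E] [SecondCountableTopology E] [MeasurableSpace E] [BorelSpace E]
    {X Y : ∀ n, Ω n → E} {Z : Ω' → E} (hX : TendstoInDistribution X atTop Z P P')
    (hY : ∀ n, AEMeasurable (Y n) (P n))
    (hXY : ∀ ε : ℝ, 0 < ε → Tendsto (fun n => P n {ω | ε ≤ ‖Y n ω - X n ω‖}) atTop (𝓝 0)) :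
    TendstoInDistribution Y atTop Z P P' := by
  have hXm := hX.forall_aemeasurable
  refine ⟨hY, hX.aemeasurable_limit, ?_⟩
  refine tendsto_iff_forall_lipschitz_integral_tendsto.mpr ?_
  rintro f ⟨M, hM⟩ ⟨L, hL⟩
  have hlim := tendsto_iff_forall_lipschitz_integral_tendsto.mp hX.tendsto f ⟨M, hM⟩ ⟨L, hL⟩
  have hf : Continuous f := hL.continuous
  simp only [ProbabilityMeasure.coe_mk] at hlim ⊢
  have hint : ∀ n (W : Ω n → E), AEMeasurable W (P n) → Integrable (fun ω => f (W ω)) (P n) := by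
    intro n W hW
    refine Integrable.of_bound (hf.measurable.comp_aemeasurable hW).aestronglyMeasurable
      (‖f 0‖ + M) (Eventually.of_forall fun ω => ?_)
    have h1 := hM (W ω) 0
    rw [dist_eq_norm] at h1
    linarith [norm_sub_norm_le (f (W ω)) (f 0)]
  rw [Metric.tendsto_atTop'] at hlim
  refine Metric.tendsto_atTop'.mpr fun ε hε => ?_
  have hM0 : 0 ≤ M := by simpa using hM 0 0
  -- Error budget: `ε/4` where `X` and `Y` are closer than `η`, `ε/4` on the exceptional event,
  -- `ε/2` for the convergence of `X`. Here `M` bounds the oscillation of `f`; `L + 1` and `M + 1`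
  -- avoid division by zero.
  set η : ℝ := ε / (4 * (L + 1)) with hη
  have hηpos : 0 < η := by positivity
  have hLη : L * η ≤ ε / 4 := by
    rw [hη, mul_div_assoc', div_le_div_iff₀ (by positivity) (by positivity)]
    nlinarith [L.2]
  have hsmall : ∀ᶠ n in atTop, (P n).real {ω | η ≤ ‖Y n ω - X n ω‖} < ε / (4 * (M + 1)) := by
    have h1 := (ENNReal.tendsto_toReal ENNReal.zero_ne_top).comp (hXY η hηpos)
    exact h1.eventually_lt_const (by simpa using by positivity)
  obtain ⟨N₁, hN₁⟩ := hlim (ε / 2) (half_pos hε)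
  obtain ⟨N₂, hN₂⟩ := eventually_atTop.mp hsmall
  refine ⟨max N₁ N₂, fun n hn => ?_⟩
  have hn₁ := hN₁ n ((le_max_left _ _).trans_lt hn)
  have hn₂ := hN₂ n ((le_max_right _ _).trans hn.le)
  set S : Set (Ω n) := {ω | η ≤ ‖Y n ω - X n ω‖}
  have hS : NullMeasurableSet S (P n) :=
    nullMeasurableSet_le aemeasurable_const ((hY n).sub (hXm n)).norm
  have hdiff : |∫ ω, f (Y n ω) ∂(P n) - ∫ ω, f (X n ω) ∂(P n)| ≤
      L * η + M * (P n).real S := by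
    rw [← integral_sub (hint n _ (hY n)) (hint n _ (hXm n)), ← Real.norm_eq_abs]
    have hg : Integrable (fun ω => L * η + S.indicator (fun _ => M) ω) (P n) :=
      (integrable_const _).add ((integrable_const M).indicator₀ hS)
    refine (norm_integral_le_of_norm_le hg (Eventually.of_forall fun ω => ?_)).trans_eq ?_
    · rw [← dist_eq_norm]
      by_cases hω : ω ∈ S
      · rw [indicator_of_mem hω]
        exact (hM _ _).trans (le_add_of_nonneg_left (by positivity))
      · rw [indicator_of_notMem hω, add_zero]
        refine (hL.dist_le_mul _ _).trans ?_
        rw [dist_eq_norm]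
        gcongr
        exact (not_le.mp hω).le
    · rw [integral_add (integrable_const _) ((integrable_const M).indicator₀ hS),
        integral_indicator₀ hS]
      simp [mul_comm]
  rw [integral_map (hXm n) hf.aestronglyMeasurable] at hn₁
  rw [integral_map (hY n) hf.aestronglyMeasurable]
  have hMS : M * (P n).real S ≤ ε / 4 * (M / (M + 1)) := by
    calc M * (P n).real S ≤ M * (ε / (4 * (M + 1))) := by gcongr
      _ = ε / 4 * (M / (M + 1)) := by field_simp
  have hMM : M / (M + 1) < 1 := (div_lt_one (by positivity)).mpr (by linarith)
  calc dist (∫ ω, f (Y n ω) ∂(P n)) _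
      ≤ dist (∫ ω, f (Y n ω) ∂(P n)) (∫ ω, f (X n ω) ∂(P n)) + dist _ _ := dist_triangle _ _ _
    _ < ε := by
      rw [Real.dist_eq]
      nlinarith

/-- The portmanteau theorem for the closed half-line; it carries tail bounds from the limit to all
large `n`. -/
theorem MeasureTheory.TendstoInDistribution.eventually_measure_ge_lt {X : ∀ n, Ω n → ℝ} {Z : Ω' → ℝ}
    (h : TendstoInDistribution X atTop Z P P') {c : ℝ} {κ : ENNReal}
    (hκ : P' {ω | c ≤ Z ω} < κ) : ∀ᶠ n in atTop, P n {ω | c ≤ X n ω} < κ := by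
  have hlim := ProbabilityMeasure.limsup_measure_closed_le_of_tendsto h.tendsto
    (isClosed_Ici (a := c))
  simp only [ProbabilityMeasure.coe_mk] at hlim
  rw [Measure.map_apply_of_aemeasurable h.aemeasurable_limit measurableSet_Ici] at hlim
  filter_upwards [eventually_lt_of_limsup_lt (hlim.trans_lt hκ)] with n hn
  rwa [Measure.map_apply_of_aemeasurable (h.forall_aemeasurable n) measurableSet_Ici] at hn

theorem exists_measure_ge_lt {Z : Ω' → ℝ} (hZ : AEMeasurable Z P') {κ : ENNReal} (hκ : 0 < κ) :
    ∃ M : ℝ, 0 < M ∧ P' {ω | M ≤ Z ω} < κ := by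
  have h := tendsto_measure_iInter_atTop (μ := P') (s := fun n : ℕ => {ω | (n : ℝ) + 1 ≤ Z ω})
    (fun n => nullMeasurableSet_le aemeasurable_const hZ)
    (fun m n hmn ω (hω : (n : ℝ) + 1 ≤ Z ω) =>
      show (m : ℝ) + 1 ≤ Z ω from (add_le_add_left (Nat.cast_le.mpr hmn) 1).trans hω) ⟨0, measure_ne_top _ _⟩
  have hempty : ⋂ n : ℕ, {ω | (n : ℝ) + 1 ≤ Z ω} = ∅ := by
    refine eq_empty_of_forall_notMem fun ω hω => ?_
    obtain ⟨n, hn⟩ := exists_nat_gt (Z ω)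
    have : (n : ℝ) + 1 ≤ Z ω := mem_iInter.mp hω n
    linarith
  rw [hempty, measure_empty] at h
  obtain ⟨n, hn⟩ := (h.eventually_lt_const hκ).exists
  exact ⟨n + 1, by positivity, hn⟩

/-- Averages of an integrable function over i.i.d. samples are bounded in probability. -/
theorem IsIIDSample.exists_forall_measure_average_ge_lt {𝒰 : Type*} [MeasurableSpace 𝒰]
    {Q : Measure 𝒰} {U : ∀ n, Fin n → Ω n → 𝒰} (hU : IsIIDSample Q P U) {h : 𝒰 → ℝ}
    (hh : Integrable h Q) {κ : ENNReal} (hκ : 0 < κ) :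
    ∃ M : ℝ, 0 < M ∧ ∀ n, P n {ω | M ≤ (n : ℝ)⁻¹ * ∑ i, |h (U n i ω)|} < κ := by
  set C : ℝ := ∫ u, |h u| ∂Q with hC
  have hC0 : 0 ≤ C := integral_nonneg fun _ => abs_nonneg _
  obtain ⟨r, hr0, hrκ⟩ : ∃ r : ℝ, 0 < r ∧ ENNReal.ofReal r < κ := by
    obtain ⟨r, hr0, hrκ⟩ := ENNReal.lt_iff_exists_nnreal_btwn.mp hκ
    exact ⟨r, by simpa using hr0, by simpa using hrκ⟩
  -- Markov's inequality at this level gives probability at most `C r/(C + 1) ≤ r`; the `+ 1` keeps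
  -- the level positive when `C = 0`.
  refine ⟨(C + 1) / r, by positivity, fun n => lt_of_le_of_lt ?_ hrκ⟩
  have hlaw : ∀ i, Integrable (fun ω => |h (U n i ω)|) (P n) ∧
      ∫ ω, |h (U n i ω)| ∂(P n) = C := by
    intro i
    have hi := (hU n).2 i
    have hm := hi.map_eq
    have habs : Integrable (fun u => |h u|) ((P n).map (U n i)) := by rw [hm]; exact hh.abs
    refine ⟨(integrable_map_measure habs.aestronglyMeasurable hi.aemeasurable).mp habs, ?_⟩
    rw [hC, ← hm, integral_map hi.aemeasurable habs.aestronglyMeasurable]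
  have hint : Integrable (fun ω => (n : ℝ)⁻¹ * ∑ i, |h (U n i ω)|) (P n) :=
    (integrable_finsetSum _ fun i _ => (hlaw i).1).const_mul _
  have hval : ∫ ω, (n : ℝ)⁻¹ * ∑ i, |h (U n i ω)| ∂(P n) ≤ C := by
    rw [integral_const_mul, integral_finsetSum _ fun i _ => (hlaw i).1]
    simp only [fun i => (hlaw i).2, Finset.sum_const, Finset.card_univ, Fintype.card_fin,
      nsmul_eq_mul]
    rw [← mul_assoc]
    -- An inequality only, since for `n = 0` the factor `n⁻¹ * n` is `0`.
    exact mul_le_of_le_one_left hC0 (inv_mul_le_one)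
  have hmarkov := mul_meas_ge_le_integral_of_nonneg
    (Eventually.of_forall fun ω => by positivity) hint ((C + 1) / r)
  have hreal : (P n).real {ω | (C + 1) / r ≤ (n : ℝ)⁻¹ * ∑ i, |h (U n i ω)|} ≤ r := by
    have h1 := hmarkov.trans hval
    rw [div_mul_eq_mul_div, div_le_iff₀ hr0] at h1
    have h2 : (0 : ℝ) ≤ (P n).real {ω | (C + 1) / r ≤ (n : ℝ)⁻¹ * ∑ i, |h (U n i ω)|} :=
      measureReal_nonneg
    have h3 : (C + 1) * (P n).real {ω | (C + 1) / r ≤ (n : ℝ)⁻¹ * ∑ i, |h (U n i ω)|} ≤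
        (C + 1) * r := h1.trans (by nlinarith)
    exact le_of_mul_le_mul_left h3 (by positivity)
  rw [← ofReal_measureReal (measure_ne_top _ _)]
  exact ENNReal.ofReal_le_ofReal hreal

end Convergence

/-! ### Bounded continuous functions along a path -/

section AlongPath

variable {p : ℕ} {T : ℝ} {S : Set (Euc p)}

/-- Composition of a bounded continuous function on `S` with a path in `S`. -/
noncomputable def alongPath (x : C(Icc (0 : ℝ) T, S)) (f : S →ᵇ Euc p) : PathSpace T (Euc p) :=
  (f : C(S, Euc p)).comp x

theorem continuous_alongPath (x : C(Icc (0 : ℝ) T, S)) : Continuous (alongPath x) := by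
  refine LipschitzWith.continuous (K := 1) (LipschitzWith.of_dist_le_mul fun f h => ?_)
  rw [NNReal.coe_one, one_mul, ContinuousMap.dist_le dist_nonneg]
  exact fun t => f.dist_coe_le_dist (x t)

/-- Pairs of a time `t` and a point of `S` within distance `δ` of `x t`. -/
abbrev NearPath (x : C(Icc (0 : ℝ) T, S)) (δ : ℝ) : Type :=
  {q : Icc (0 : ℝ) T × S // dist q.2 (x q.1) ≤ δ}

/-- The increments of `f` between the path `x` and points within distance `δ`. -/
noncomputable def pathIncrements (x : C(Icc (0 : ℝ) T, S)) (δ : ℝ) (f : S →ᵇ Euc p) :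
    NearPath x δ →ᵇ Euc p :=
  f.compContinuous ⟨fun q => q.1.2, by fun_prop⟩ -
    f.compContinuous ⟨fun q => x q.1.1, by fun_prop⟩

/-- Continuity in `f` at fixed `δ` lets the continuous mapping theorem pass moduli of continuity
along `x` to the limit; this supplies the asymptotic equicontinuity of the empirical gradients. -/
theorem continuous_pathIncrements (x : C(Icc (0 : ℝ) T, S)) (δ : ℝ) :
    Continuous (pathIncrements x δ) :=
  (BoundedContinuousFunction.continuous_compContinuous _).sub
    (BoundedContinuousFunction.continuous_compContinuous _)

theorem norm_sub_le_norm_pathIncrements (x : C(Icc (0 : ℝ) T, S)) {δ : ℝ} (f : S →ᵇ Euc p)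
    {t : Icc (0 : ℝ) T} {y : S} (h : dist y (x t) ≤ δ) :
    ‖f y - f (x t)‖ ≤ ‖pathIncrements x δ f‖ :=
  (pathIncrements x δ f).norm_coe_le_norm ⟨(t, y), h⟩

/-- `S` need not be compact, but the range of `x` is, and a continuous function is uniformly
continuous at a compact set, also towards points outside it. -/
theorem tendsto_norm_pathIncrements (x : C(Icc (0 : ℝ) T, S)) (f : S →ᵇ Euc p) :
    Tendsto (fun k : ℕ => ‖pathIncrements x (1 / ((k : ℝ) + 1)) f‖) atTop (𝓝 0) := by
  rw [Metric.tendsto_atTop]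
  intro ε hε
  have hK : IsCompact (range x) := isCompact_range x.continuous
  have hunif := hK.uniformContinuousAt_of_continuousAt f
    (fun a _ => f.continuous.continuousAt) (Metric.dist_mem_uniformity (half_pos hε))
  obtain ⟨δ, hδ, h⟩ := Metric.mem_uniformity_dist.mp hunif
  obtain ⟨N, hN⟩ := exists_nat_one_div_lt hδ
  refine ⟨N, fun k hk => ?_⟩
  rw [Real.dist_eq, sub_zero, abs_of_nonneg (norm_nonneg _)]
  refine lt_of_le_of_lt ?_ (half_lt_self hε)
  rw [BoundedContinuousFunction.norm_le (half_pos hε).le]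
  rintro ⟨⟨t, y⟩, hq⟩
  have hkδ : 1 / ((k : ℝ) + 1) < δ := (Nat.one_div_le_one_div hk).trans_lt hN
  have := h (a := x t) (b := y) (by rw [dist_comm]; exact hq.trans_lt hkδ) (mem_range_self t)
  rw [mem_ofPred_eq, dist_comm, dist_eq_norm] at this
  exact this.le

end AlongPath

/-! ### Comparison of the perturbed and the limiting curve -/

section Comparison

variable {T : ℝ}

/-- The rescaled difference of two solutions, as a solution of an integral equation. -/
theorem Scheme.smul_sub_eq_forcingCLM {F : Type*} [NormedAddCommGroup F] [NormedSpace ℝ F]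
    [CompleteSpace F] (s : Scheme) (hT : 0 ≤ T) {b b' : F → F} {x₀ y₀ : F} {x y : PathSpace T F}
    (hx : s.Solves hT (fun _ => b) x₀ x) (hy : s.Solves hT (fun _ => b') y₀ y) (c : ℝ)
    (fx fy : PathSpace T F) (hfx : ∀ t, fx t = b (x t)) (hfy : ∀ t, fy t = b' (y t)) :
    c • (x - y) = ContinuousMap.const _ (c • (x₀ - y₀)) + s.forcingCLM hT (c • (fx - fy)) := by
  have hx' := (s.solves_iff_eq_forcingMap (b := fun _ => b) hT fx hfx).mp hx
  have hy' := (s.solves_iff_eq_forcingMap (b := fun _ => b') hT fy hfy).mp hy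
  have : x - y = ContinuousMap.const _ (x₀ - y₀) + s.forcingCLM hT (fx - fy) := by
    nth_rewrite 1 [hx', hy']
    rw [map_sub]
    change _ = (ContinuousMap.const _ x₀ - ContinuousMap.const _ y₀) +
      (s.forcingMap hT fx - s.forcingMap hT fy)
    abel
  rw [this, smul_add, map_smul]
  rfl

/-- The a priori Grönwall bound, explicit in `H` and `r` so that both may later be random quantities
bounded in probability. -/
theorem Scheme.norm_le_of_forcing_le {F : Type*} [NormedAddCommGroup F] [NormedSpace ℝ F]
    (s : Scheme) (hT : 0 ≤ T) {v β : PathSpace T F} {v₀ : F} {H r : ℝ} (hH : 0 ≤ H) (hr : 0 ≤ r)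
    (hv : v = ContinuousMap.const _ v₀ + s.forcingCLM hT β)
    (hβ : ∀ t, ‖β t‖ ≤ H * ‖v t‖ + r) :
    ‖v‖ ≤ (‖v₀‖ + max 1 T * (r * T)) * Real.exp (max 1 T * H * T) := by
  have hmax : 0 ≤ max 1 T := zero_le_one.trans (le_max_left _ _)
  have hc : Continuous fun u => ‖IccExtend hT v u‖ := (v.continuous_extend hT).norm
  rw [ContinuousMap.norm_le _ (by positivity)]
  refine PathSpace.norm_le_of_integral_le hT (by positivity) (by positivity) fun t => ?_
  have hvt : v t = v₀ + s.forcingCLM hT β t := congrArg (fun w : PathSpace T F => w t) hv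
  have hint : ∫ u in (0 : ℝ)..t, ‖IccExtend hT β u‖ ≤
      H * (∫ u in (0 : ℝ)..t, ‖IccExtend hT v u‖) + r * T := by
    refine (integral_norm_extend_le hT β (φ := fun u => H * ‖IccExtend hT v u‖ + r)
      (by fun_prop) (fun u => ?_) t).trans ?_
    · rw [PathSpace.extend_apply]
      exact hβ u
    · rw [intervalIntegral.integral_add ((hc.const_mul H).intervalIntegrable _ _)
        (continuous_const.intervalIntegrable _ _), intervalIntegral.integral_const_mul,
        intervalIntegral.integral_const, sub_zero, smul_eq_mul, mul_comm (t : ℝ) r]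
      gcongr
      exact t.2.2
  rw [hvt]
  calc ‖v₀ + s.forcingCLM hT β t‖
      ≤ ‖v₀‖ + max 1 T * (H * (∫ u in (0 : ℝ)..t, ‖IccExtend hT v u‖) + r * T) :=
        (norm_add_le _ _).trans (add_le_add_right
          ((s.norm_forcingCLM_apply_le hT β t).trans (by gcongr)) _)
    _ = _ := by ring

/-- If the rescaled difference `R` of the vector fields `b` and `b'` is under control, so is the
distance of the rescaled difference of the solutions to the solution of the linearized equation
driven by `R` along the limiting curve. -/
theorem Scheme.norm_smul_sub_sub_le {p : ℕ} {S Θ : Set (Euc p)} (hSΘ : S ⊆ Θ) (s : Scheme)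
    (hT : 0 ≤ T) {b b' : Euc p → Euc p} {H c : ℝ} (hH : 0 ≤ H) (hc : 0 < c)
    (hb : ∀ θ ∈ Θ, ∀ ϑ ∈ Θ, ‖b θ - b ϑ‖ ≤ H * ‖θ - ϑ‖) (hb' : ContinuousOn b' Θ)
    {x₀ y₀ : Euc p} {x : C(Icc (0 : ℝ) T, S)} {X Y : PathSpace T (Euc p)} (hxX : ∀ t, x t = X t)
    (hX : s.Solves hT (fun _ => b') x₀ X) (hY : s.Solves hT (fun _ => b) y₀ Y)
    (hYΘ : ∀ t, Y t ∈ Θ) {R : S →ᵇ Euc p} (hR : ∀ θ : S, R θ = c • (b θ - b' θ))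
    {A : PathSpace T (Euc p →L[ℝ] Euc p)} {Φ : PathSpace T (Euc p) →L[ℝ] PathSpace T (Euc p)}
    {C : ℝ} (hC : 0 ≤ C)
    (hΦ : ∀ (f β v : PathSpace T (Euc p)) (v₀ : Euc p),
      v = ContinuousMap.const _ v₀ + s.forcingCLM hT β →
        ‖v - Φ f‖ ≤ C * (‖v₀‖ + ‖β - (PathSpace.applyCLM A v + f)‖))
    {δ η MR MH M : ℝ}
    (hdiff : ∀ t, ∀ y, ‖y - X t‖ ≤ δ → ‖b' y - b' (X t) - A t (y - X t)‖ ≤ η * ‖y - X t‖)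
    (hball : ∀ t, ∀ y, ‖y - X t‖ ≤ δ → y ∈ S) (hη : 0 ≤ η) (hη1 : η ≤ 1)
    (hHM : H ≤ MH) (hRM : ‖R‖ ≤ MR) (hosc : ‖pathIncrements x δ R‖ ≤ η)
    (hinit : ‖c • (y₀ - x₀)‖ ≤ η)
    (hM : M = (1 + max 1 T * (MR * T)) * Real.exp (max 1 T * MH * T)) (hMc : M ≤ c * δ) :
    ‖c • (Y - X) - Φ (alongPath x R)‖ ≤ C * (η + (η + η * M)) := by
  have hmax : 0 ≤ max 1 T := zero_le_one.trans (le_max_left _ _)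
  have hR0 : 0 ≤ ‖R‖ := norm_nonneg R
  have hXS : ∀ t, X t ∈ S := fun t => hxX t ▸ (x t).2
  have hbc : ContinuousOn b Θ := by
    refine (LipschitzOnWith.of_dist_le_mul (K := ⟨H, hH⟩) fun θ hθ ϑ hϑ => ?_).continuousOn
    rw [dist_eq_norm, dist_eq_norm]
    exact hb θ hθ ϑ hϑ
  let fY : PathSpace T (Euc p) := ⟨fun t => b (Y t), hbc.comp_continuous Y.continuous hYΘ⟩
  let fX : PathSpace T (Euc p) :=
    ⟨fun t => b' (X t), hb'.comp_continuous X.continuous fun t => hSΘ (hXS t)⟩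
  have hV := s.smul_sub_eq_forcingCLM hT hY hX c fY fX (fun _ => rfl) (fun _ => rfl)
  set V : PathSpace T (Euc p) := c • (Y - X)
  have hVt : ∀ t, ‖V t‖ = c * ‖Y t - X t‖ := fun t => by
    change ‖c • (Y t - X t)‖ = _
    rw [norm_smul, Real.norm_of_nonneg hc.le]
  have hVM : ‖V‖ ≤ M := by
    refine (s.norm_le_of_forcing_le hT hH hR0 hV fun t => ?_).trans ?_
    · change ‖c • (b (Y t) - b' (X t))‖ ≤ _
      -- Inserting `b (X t)` evaluates `R` only on the limiting curve; `Y t` is not yet known to lie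
      -- in `S`.
      have h1 : c • (b (Y t) - b' (X t)) = c • (b (Y t) - b (X t)) + R (x t) := by
        rw [hR, hxX, ← smul_add]
        congr 1
        abel
      rw [h1, hVt]
      refine (norm_add_le _ _).trans (add_le_add ?_ (R.norm_coe_le_norm _))
      rw [norm_smul, Real.norm_of_nonneg hc.le, mul_left_comm]
      exact mul_le_mul_of_nonneg_left (hb _ (hYΘ t) _ (hSΘ (hXS t))) hc.le
    · rw [hM]
      have hinit' := hinit.trans hη1
      have hMR : 0 ≤ MR := hR0.trans hRM
      gcongr
  have hclose : ∀ t, ‖Y t - X t‖ ≤ δ := fun t => by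
    have h1 := (V.norm_coe_le_norm t).trans (hVM.trans hMc)
    rw [hVt] at h1
    exact le_of_mul_le_mul_left h1 hc
  have hrem : ‖c • (fY - fX) - (PathSpace.applyCLM A V + alongPath x R)‖ ≤ η + η * M := by
    have hM0 : 0 ≤ M := (norm_nonneg V).trans hVM
    rw [ContinuousMap.norm_le _ (by positivity)]
    intro t
    change ‖c • (b (Y t) - b' (X t)) - (A t (c • (Y t - X t)) + R (x t))‖ ≤ _
    set y : S := ⟨Y t, hball t _ (hclose t)⟩
    have hyx : dist y (x t) ≤ δ := by
      rw [Subtype.dist_eq, dist_eq_norm, hxX]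
      exact hclose t
    -- Now `Y t ∈ S`, so inserting `b' (Y t)` is allowed: an increment of `R` plus the linearization
    -- error of `b'`.
    have h1 : c • (b (Y t) - b' (X t)) - (A t (c • (Y t - X t)) + R (x t)) =
        (R y - R (x t)) + c • (b' (Y t) - b' (X t) - A t (Y t - X t)) := by
      rw [hR y, map_smul]
      module
    rw [h1]
    refine (norm_add_le _ _).trans
      (add_le_add ((norm_sub_le_norm_pathIncrements x R hyx).trans hosc) ?_)
    rw [norm_smul, Real.norm_of_nonneg hc.le]
    calc c * ‖b' (Y t) - b' (X t) - A t (Y t - X t)‖ ≤ c * (η * ‖Y t - X t‖) := by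
          gcongr
          exact hdiff t _ (hclose t)
      _ = η * ‖V t‖ := by rw [hVt]; ring
      _ ≤ η * M := by
          gcongr
          exact (V.norm_coe_le_norm t).trans hVM
  exact (hΦ _ _ V _ hV).trans (mul_le_mul_of_nonneg_left (add_le_add hinit hrem) hC)

end Comparison

/-! ### Asymptotic equivalence, the matrix equation and the limit theorem -/

section Main

variable {p : ℕ} {𝒰 : Type*} [MeasurableSpace 𝒰] {Q : Measure 𝒰} {Θ ΘX : Set (Euc p)}
  {ℓ : Euc p → 𝒰 → ℝ} {g : Euc p → ℝ} {T : ℝ}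

/-- The rescaled difference of the curves is asymptotically equivalent to the solution of the
linearized equation driven by the centered gradients along the limiting curve. -/
theorem tendsto_measure_norm_smul_sub_sub_ge [IsProbabilityMeasure Q]
    {Ω : ℕ → Type*} [∀ n, MeasurableSpace (Ω n)] {P : ∀ n, Measure (Ω n)}
    [∀ n, IsProbabilityMeasure (P n)] {U : ∀ n, Fin n → Ω n → 𝒰} (hU : IsIIDSample Q P U)
    {Ω' : Type*} [MeasurableSpace Ω'] {P' : Measure Ω'} [IsProbabilityMeasure P']
    {x₀ : Euc p} {xinit : ∀ n, Ω n → Euc p}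
    (hinit : IsLittleOPRootN P (fun n ω => xinit n ω - x₀))
    (hℓ : LossRegularity Q Θ ℓ) (hg : PopulationRegularity Q Θ ℓ g) (hΘX : ΘX ⊆ Θ)
    (s : Scheme) (hT : 0 ≤ T) {X : PathSpace T (Euc p)}
    (hX : s.Solves hT (fun _ θ => ∇ g θ) x₀ X) (hX_mem : ∀ t, X t ∈ interior ΘX)
    {Xn : ∀ n, Ω n → PathSpace T (Euc p)}
    (hXn : ∀ n, ∀ᵐ ω ∂(P n), (∀ t, Xn n ω t ∈ Θ) ∧
      s.Solves hT (fun _ θ => ∇ (empiricalLoss ℓ (fun i => U n i ω)) θ)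
        (xinit n ω) (Xn n ω))
    {R : ∀ n, Ω n → (ΘX →ᵇ Euc p)} {Z : Ω' → (ΘX →ᵇ Euc p)}
    (hR : ∀ n, ∀ᵐ ω ∂(P n), ∀ θ : ΘX,
      R n ω θ = centeredGradient ℓ g (fun i => U n i ω) θ)
    (hRZ : TendstoInDistribution R atTop Z P P')
    {x : C(Icc (0 : ℝ) T, ΘX)} (hxX : ∀ t, x t = X t)
    {A : PathSpace T (Euc p →L[ℝ] Euc p)} (hA : ∀ t, A t = fderiv ℝ (∇ g) (X t))
    {Φ : PathSpace T (Euc p) →L[ℝ] PathSpace T (Euc p)} {C : ℝ} (hC : 0 ≤ C)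
    (hΦ : ∀ (f β v : PathSpace T (Euc p)) (v₀ : Euc p),
      v = ContinuousMap.const _ v₀ + s.forcingCLM hT β →
        ‖v - Φ f‖ ≤ C * (‖v₀‖ + ‖β - (PathSpace.applyCLM A v + f)‖))
    {ε : ℝ} (hε : 0 < ε) :
    Tendsto (fun n : ℕ => P n {ω | ε ≤ ‖Real.sqrt n • (Xn n ω - X) - Φ (alongPath x (R n ω))‖})
      atTop (𝓝 0) := by
  have hmax : 0 ≤ max 1 T := zero_le_one.trans (le_max_left _ _)
  rw [ENNReal.tendsto_nhds_zero]
  intro κ hκ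
  -- Four exceptional events share `κ`: large `R n`, large increments of `R n`, large initial error,
  -- large empirical Lipschitz constant.
  have hκ4 : 0 < κ / 4 := ENNReal.div_pos hκ.ne' (by norm_num)
  obtain ⟨h₁, hh₁, hlip⟩ := hℓ.lipschitz
  obtain ⟨L, -, hL⟩ := hg.lipschitz
  obtain ⟨MH, hMH0, hMH⟩ := hU.exists_forall_measure_average_ge_lt
    (hh₁.integrable (by norm_num)) hκ4
  have hnorm : TendstoInDistribution (fun n ω => ‖R n ω‖) atTop (fun ω => ‖Z ω‖) P P' :=
    hRZ.continuous_comp continuous_norm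
  obtain ⟨MR, hMR0, hMR⟩ := exists_measure_ge_lt hnorm.aemeasurable_limit hκ4
  -- The summand `1` bounds the rescaled initial error, thanks to `η ≤ 1`. Thus `M` does not depend
  -- on `η`, which can be chosen afterwards.
  set M : ℝ := (1 + max 1 T * (MR * T)) * Real.exp (max 1 T * MH * T) with hM
  have hM0 : 0 < M := by positivity
  set η : ℝ := min 1 (ε / (2 * (C + 1) * (2 + M))) with hη
  have hη0 : 0 < η := lt_min one_pos (by positivity)
  have hηε : C * (η + (η + η * M)) < ε := by
    have h1 : η * (2 * (C + 1) * (2 + M)) ≤ ε :=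
      (le_div_iff₀ (by positivity)).mp (min_le_right _ _)
    have h2 : 0 ≤ C * (η * (2 + M)) := by positivity
    have h3 : 0 < η * (2 + M) := by positivity
    nlinarith
  have hK : IsCompact (range X) := isCompact_range X.continuous
  have hXΘ : ∀ t, X t ∈ Θ := fun t => hΘX (interior_subset (hX_mem t))
  obtain ⟨δ₁, hδ₁, hdiff⟩ := hK.exists_forall_norm_sub_sub_fderiv_le (f := ∇ g)
    (by rintro _ ⟨t, rfl⟩; exact contDiffAt_gradient (hg.contDiff _ (hXΘ t))) hη0
  obtain ⟨δ₂, hδ₂, hball⟩ := hK.exists_cthickening_subset_open isOpen_interior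
    (by rintro _ ⟨t, rfl⟩; exact hX_mem t)
  -- The tube radius is chosen from the limit process alone, before `n`, and small enough for the
  -- Taylor estimate and for the tube to stay in `ΘX`.
  obtain ⟨k, hk, hkδ⟩ : ∃ k : ℕ, P' {ω | η ≤ ‖pathIncrements x (1 / ((k : ℝ) + 1)) (Z ω)‖} < κ / 4 ∧
      1 / ((k : ℝ) + 1) < min δ₁ δ₂ := by
    have hmeas : TendstoInMeasure P'
        (fun (k : ℕ) ω => ‖pathIncrements x (1 / ((k : ℝ) + 1)) (Z ω)‖) atTop fun _ => 0 := by
      refine tendstoInMeasure_of_tendsto_ae (fun k => ?_)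
        (Eventually.of_forall fun ω => tendsto_norm_pathIncrements x (Z ω))
      exact ((continuous_pathIncrements x _).norm.measurable.comp_aemeasurable
        hRZ.aemeasurable_limit).aestronglyMeasurable
    rw [tendstoInMeasure_iff_norm] at hmeas
    have h1 := (hmeas η hη0).eventually_lt_const hκ4
    simp only [sub_zero, norm_norm] at h1
    exact (h1.and (tendsto_one_div_add_atTop_nhds_zero_nat.eventually_lt_const
      (lt_min hδ₁ hδ₂))).exists
  set δ : ℝ := 1 / ((k : ℝ) + 1)
  have hδ0 : 0 < δ := Nat.one_div_pos_of_nat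
  have hosc : TendstoInDistribution (fun n ω => ‖pathIncrements x δ (R n ω)‖) atTop
      (fun ω => ‖pathIncrements x δ (Z ω)‖) P P' :=
    hRZ.continuous_comp (g := fun f => ‖pathIncrements x δ f‖) (continuous_pathIncrements x δ).norm
  have hsqrt : ∀ᶠ n : ℕ in atTop, M / δ ≤ Real.sqrt n :=
    (Real.tendsto_sqrt_atTop.comp tendsto_natCast_atTop_atTop).eventually_ge_atTop _
  filter_upwards [hnorm.eventually_measure_ge_lt hMR, hosc.eventually_measure_ge_lt hk, hsqrt,
    (hinit η hη0).eventually_lt_const hκ4] with n hn1 hn2 hn3 hn4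
  have hc : 0 < Real.sqrt n := (div_pos hM0 hδ0).trans_le hn3
  set B₁ : Set (Ω n) := {ω | MR ≤ ‖R n ω‖}
  set B₂ : Set (Ω n) := {ω | η ≤ ‖pathIncrements x δ (R n ω)‖}
  set B₃ : Set (Ω n) := {ω | η ≤ Real.sqrt n * ‖xinit n ω - x₀‖}
  set B₄ : Set (Ω n) := {ω | MH ≤ (n : ℝ)⁻¹ * ∑ i, |h₁ (U n i ω)|}
  have hsub : {ω | ε ≤ ‖Real.sqrt n • (Xn n ω - X) - Φ (alongPath x (R n ω))‖} ≤ᵐ[P n]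
      ((B₁ ∪ B₂) ∪ (B₃ ∪ B₄) : Set (Ω n)) := by
    filter_upwards [hXn n, hR n] with ω hω hRω hε'
    by_contra hbad
    obtain ⟨hbad1, hbad2⟩ := not_or.mp hbad
    obtain ⟨h1, h2⟩ := not_or.mp hbad1
    obtain ⟨h3, h4⟩ := not_or.mp hbad2
    refine (lt_irrefl ε) (lt_of_le_of_lt (le_trans hε' ?_) hηε)
    refine s.norm_smul_sub_sub_le (b := ∇ (empiricalLoss ℓ fun i => U n i ω)) (b' := ∇ g)
      (H := (n : ℝ)⁻¹ * ∑ i, |h₁ (U n i ω)|) (δ := δ) (MR := MR) (MH := MH) hΘX hT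
      (by positivity) hc
      (fun θ hθ ϑ hϑ => norm_gradient_empiricalLoss_sub_le hℓ.contDiff hlip _ hθ hϑ)
      hL.continuousOn hxX hX hω.2 hω.1 (fun θ => hRω θ) hC hΦ (fun t y hy => ?_)
      (fun t y hy => ?_) hη0.le (min_le_left _ _) (not_le.mp h4).le (not_le.mp h1).le
      (not_le.mp h2).le ?_ hM ?_
    · rw [hA]
      exact hdiff _ (mem_range_self t) y (hy.trans (hkδ.le.trans (min_le_left _ _)))
    · refine interior_subset (hball (Metric.mem_cthickening_of_dist_le y (X t) δ₂ _
        (mem_range_self t) ?_))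
      rw [dist_eq_norm]
      exact hy.trans (hkδ.le.trans (min_le_right _ _))
    · rw [norm_smul, Real.norm_of_nonneg hc.le]
      exact (not_le.mp h3).le
    · exact (div_le_iff₀ hδ0).mp hn3
  calc P n {ω | ε ≤ ‖Real.sqrt n • (Xn n ω - X) - Φ (alongPath x (R n ω))‖}
      ≤ P n ((B₁ ∪ B₂) ∪ (B₃ ∪ B₄)) := measure_mono_ae hsub
    _ ≤ (P n B₁ + P n B₂) + (P n B₃ + P n B₄) :=
        (measure_union_le _ _).trans (add_le_add (measure_union_le _ _) (measure_union_le _ _))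
    _ ≤ (κ / 4 + κ / 4) + (κ / 4 + κ / 4) := by
        gcongr
        exact (hMH n).le
    _ = κ := by
        rw [← two_mul, ← two_mul, ← mul_assoc]
        norm_num
        exact ENNReal.mul_div_cancel (by norm_num) (by norm_num)

/-- The matrix equation, and its relation to the vector equation with the forcing `σ(X) z`. -/
theorem exists_matrix_solution (s : Scheme) (hT : 0 ≤ T)
    {H N : Icc (0 : ℝ) T → Matrix (Fin p) (Fin p) ℝ} (hH : Continuous H) (hN : Continuous N) :
    ∃ Pi : PathSpace T (Matrix (Fin p) (Fin p) ℝ),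
      (∀ M : PathSpace T (Matrix (Fin p) (Fin p) ℝ),
        s.Solves hT (fun t A => H t * A + N t) 0 M ↔ M = Pi) ∧
      ∀ z : Euc p, ∃ v : PathSpace T (Euc p),
        (∀ t, v t = Matrix.toEuclideanCLM (𝕜 := ℝ) (Pi t) z) ∧
        s.Solves hT (fun t y => Matrix.toEuclideanCLM (𝕜 := ℝ) (H t) y +
          Matrix.toEuclideanCLM (𝕜 := ℝ) (N t) z) 0 v := by
  have : CompleteSpace (Matrix (Fin p) (Fin p) ℝ) := FiniteDimensional.complete ℝ _
  -- Left multiplication by `H t` makes the matrix equation an instance of the abstract linear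
  -- equation.
  let A : PathSpace T (Matrix (Fin p) (Fin p) ℝ →L[ℝ] Matrix (Fin p) (Fin p) ℝ) :=
    ⟨fun t => ContinuousLinearMap.mul ℝ (Matrix (Fin p) (Fin p) ℝ) (H t),
      (ContinuousLinearMap.mul ℝ (Matrix (Fin p) (Fin p) ℝ)).continuous.comp hH⟩
  let f : PathSpace T (Matrix (Fin p) (Fin p) ℝ) := ⟨N, hN⟩
  obtain ⟨Φ, hΦ, -⟩ := s.exists_linear_solution hT A
  refine ⟨Φ f, fun M => hΦ f M, fun z => ?_⟩
  let Λ : Matrix (Fin p) (Fin p) ℝ →L[ℝ] Euc p := LinearMap.toContinuousLinearMap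
    { toFun := fun M => Matrix.toEuclideanCLM (𝕜 := ℝ) M z
      map_add' := fun M M' => by rw [map_add]; rfl
      map_smul' := fun c M => by rw [map_smul]; rfl }
  refine ⟨(Λ : C(Matrix (Fin p) (Fin p) ℝ, Euc p)).comp (Φ f), fun t => rfl, ?_⟩
  have h := ((hΦ f (Φ f)).mpr rfl).map_clm Λ
    (b' := fun t y => Matrix.toEuclideanCLM (𝕜 := ℝ) (H t) y +
      Matrix.toEuclideanCLM (𝕜 := ℝ) (N t) z) fun t M => by
    change Matrix.toEuclideanCLM (𝕜 := ℝ) (H t * M + N t) z = _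
    rw [map_add, map_mul]
    rfl
  rwa [map_zero] at h

end Main

theorem theorem3p1 {p : ℕ} {𝒰 : Type*} [MeasurableSpace 𝒰] (Q : Measure 𝒰)
    [IsProbabilityMeasure Q]
    (Θ ΘX : Set (Euc p)) (ℓ : Euc p → 𝒰 → ℝ) (g : Euc p → ℝ)
    {Ω : ℕ → Type*} [∀ n, MeasurableSpace (Ω n)]
    (P : ∀ n, Measure (Ω n)) [∀ n, IsProbabilityMeasure (P n)]
    (U : ∀ n, Fin n → Ω n → 𝒰) (hU : IsIIDSample Q P U)
    {Ω' : Type*} [MeasurableSpace Ω'] (P' : Measure Ω') [IsProbabilityMeasure P']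
    (Z : Euc p → Ω' → Euc p)
    (x₀ : Euc p) (xinit : ∀ n, Ω n → Euc p)
    (hA0 : IsLittleOPRootN P (fun n ω => xinit n ω - x₀))
    (hA1 : LossRegularity Q Θ ℓ)
    (hA2 : PopulationRegularity Q Θ ℓ g)
    (hA3 : CovarianceRegularity Q Θ ℓ)
    (hΘX : ΘX ⊆ Θ) (hΘX_bdd : Bornology.IsBounded ΘX)
    (hA4 : GradientCLT Q ΘX ℓ g P U P' Z)
    (s : Scheme) {T : ℝ} (hT : 0 < T)
    -- the deterministic curve
    (X : PathSpace T (Euc p))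
    (hX : s.Solves hT.le (fun _ θ => ∇ g θ) x₀ X)
    (hX_mem : ∀ t, X t ∈ interior ΘX)
    -- the data based curves
    (Xn : ∀ n, Ω n → PathSpace T (Euc p))
    (hXn_meas : ∀ n, AEMeasurable (Xn n) (P n))
    (hXn : ∀ n, ∀ᵐ ω ∂(P n), (∀ t, Xn n ω t ∈ Θ) ∧
      s.Solves hT.le (fun _ θ => ∇ (empiricalLoss ℓ (fun i => U n i ω)) θ)
        (xinit n ω) (Xn n ω)) :
    ∃ V : Ω' → PathSpace T (Euc p),
      -- almost surely, `V` is the unique solution of the linear equation with random forcing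
      (∀ᵐ ω ∂P', ∀ v : PathSpace T (Euc p),
        s.Solves hT.le
          (fun t y => Matrix.toEuclideanCLM (𝕜 := ℝ) (hessianMatrix g (X t)) y + Z (X t) ω)
          0 v ↔ v = V ω) ∧
      -- `Vⁿ = √n (Xⁿ - X)` converges weakly to `V` in `C([0,T])`
      TendstoInDistribution (fun (n : ℕ) ω => Real.sqrt n • (Xn n ω - X)) atTop V P P' ∧
      -- the special case `Z(θ) = σ(θ) Z₀` with `Z₀` standard normal
      ∀ Z₀ : Ω' → Euc p, HasLaw Z₀ (stdGaussian (Euc p)) P' →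
        (∀ θ ∈ ΘX, ∀ᵐ ω ∂P',
          Z θ ω = Matrix.toEuclideanCLM (𝕜 := ℝ) (sigmaMatrix ℓ Q θ) (Z₀ ω)) →
        ∃ Pi : PathSpace T (Matrix (Fin p) (Fin p) ℝ),
          (∀ M : PathSpace T (Matrix (Fin p) (Fin p) ℝ),
            s.Solves hT.le (fun t A => hessianMatrix g (X t) * A + sigmaMatrix ℓ Q (X t)) 0 M ↔
              M = Pi) ∧
          ∀ᵐ ω ∂P', ∀ t, V ω t = Matrix.toEuclideanCLM (𝕜 := ℝ) (Pi t) (Z₀ ω) := by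
  obtain ⟨R, Z', hR, hZ', hRZ⟩ := hA4.weak_limit
  have hXS : ∀ t, X t ∈ ΘX := fun t => interior_subset (hX_mem t)
  have hXg : ∀ t, ContDiffAt ℝ 2 g (X t) := fun t => hA2.contDiff _ (hΘX (hXS t))
  let x : C(Icc (0 : ℝ) T, ΘX) := ⟨fun t => ⟨X t, hXS t⟩, X.continuous.subtype_mk hXS⟩
  let A : PathSpace T (Euc p →L[ℝ] Euc p) :=
    ⟨fun t => fderiv ℝ (∇ g) (X t), continuous_fderiv_gradient_comp X.continuous hXg⟩
  obtain ⟨Φ, hΦ, C, hC, hstab⟩ := s.exists_linear_solution hT.le A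
  have hunique : ∀ᵐ ω ∂P', ∀ v : PathSpace T (Euc p),
      s.Solves hT.le
        (fun t y => Matrix.toEuclideanCLM (𝕜 := ℝ) (hessianMatrix g (X t)) y + Z (X t) ω)
        0 v ↔ v = Φ (alongPath x (Z' ω)) := by
    filter_upwards [hZ'] with ω hω v
    rw [← hΦ]
    have : (fun (t : Icc (0 : ℝ) T) (y : Euc p) =>
        Matrix.toEuclideanCLM (𝕜 := ℝ) (hessianMatrix g (X t)) y + Z (X t) ω) =
        fun t y => A t y + alongPath x (Z' ω) t := by
      funext t y
      rw [toEuclideanCLM_hessianMatrix, ← hω ⟨X t, hXS t⟩]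
      rfl
    rw [this]
  refine ⟨fun ω => Φ (alongPath x (Z' ω)), hunique, ?_, fun Z₀ _ hZ₀ => ?_⟩
  · have hlim : TendstoInDistribution (fun n ω => Φ (alongPath x (R n ω))) atTop
        (fun ω => Φ (alongPath x (Z' ω))) P P' :=
      hRZ.continuous_comp (g := fun f => Φ (alongPath x f))
        (Φ.continuous.comp (continuous_alongPath x))
    refine hlim.of_norm_sub_tendsto_zero (fun n => ?_) fun ε hε =>
      tendsto_measure_norm_smul_sub_sub_ge hU hA0 hA1 hA2 hΘX s hT.le hX hX_mem hXn hR hRZ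
        (fun _ => rfl) (fun _ => rfl) hC hstab hε
    have hcont : Continuous fun y : PathSpace T (Euc p) => Real.sqrt n • (y - X) := by fun_prop
    exact hcont.measurable.comp_aemeasurable (hXn_meas n)
  · have hσ : Continuous fun t => sigmaMatrix ℓ Q (X t) :=
      continuous_sigmaMatrix_comp hA3 X.continuous fun t => hΘX (hXS t)
    obtain ⟨Pi, hPi, hPiv⟩ := exists_matrix_solution s hT.le
      (continuous_hessianMatrix_comp X.continuous hXg) hσ
    refine ⟨Pi, hPi, ?_⟩
    -- The null set in `Z θ = σ(θ) Z₀` depends on `θ`. Countably many times give one null set, and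
    -- continuity in `t` of both sides extends the identity to `[0,T]`.
    obtain ⟨D, hDc, hDd⟩ := TopologicalSpace.exists_countable_dense (Icc (0 : ℝ) T)
    have hD : ∀ᵐ ω ∂P', ∀ t ∈ D,
        Z (X t) ω = Matrix.toEuclideanCLM (𝕜 := ℝ) (sigmaMatrix ℓ Q (X t)) (Z₀ ω) :=
      (ae_ball_iff hDc).mpr fun t _ => hZ₀ _ (hXS t)
    filter_upwards [hunique, hZ', hD] with ω hω hZω hDω
    have hσω : Continuous fun t =>
        Matrix.toEuclideanCLM (𝕜 := ℝ) (sigmaMatrix ℓ Q (X t)) (Z₀ ω) := by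
      have : Continuous fun M : Matrix (Fin p) (Fin p) ℝ =>
          Matrix.toEuclideanCLM (𝕜 := ℝ) M (Z₀ ω) :=
        LinearMap.continuous_of_finiteDimensional
          ({ toFun := fun M => Matrix.toEuclideanCLM (𝕜 := ℝ) M (Z₀ ω)
             map_add' := fun M M' => by rw [map_add]; rfl
             map_smul' := fun c M => by rw [map_smul]; rfl } :
            Matrix (Fin p) (Fin p) ℝ →ₗ[ℝ] Euc p)
      exact this.comp hσ
    have hall : ∀ t, Z (X t) ω =
        Matrix.toEuclideanCLM (𝕜 := ℝ) (sigmaMatrix ℓ Q (X t)) (Z₀ ω) := by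
      have heq := Continuous.ext_on hDd (alongPath x (Z' ω)).continuous hσω fun t ht =>
        (hZω ⟨X t, hXS t⟩).trans (hDω t ht)
      exact fun t => (hZω ⟨X t, hXS t⟩).symm.trans (congrFun heq t)
    -- For this `ω` the path `Pi t` applied to `Z₀ ω` solves the equation driven by `Z (X t) ω`, so
    -- uniqueness identifies it with `V ω`.
    obtain ⟨v, hv, hvs⟩ := hPiv (Z₀ ω)
    simp_rw [← hall] at hvs
    rw [hω] at hvs
    intro t
    rw [← hv t, hvs]
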